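/- Let $\mathcal A$ be a countable abelian group with a coloring map $\theta:\mathcal A\times\mathcal A\to\mathbb C^\times$, i.e. a map with $\theta(a+b,c)=\theta(a,c)\theta(b,c)$, $\theta(a,b+c)=\theta(a,b)\theta(a,c)$ and $\theta(a,b)\theta(b,a)=1$, and let $\psi(a)=\theta(a,a)\in\{\pm1\}$; call $a$ odd if $\psi(a)=-1$. Let $\Gamma$ be a countable abelian semigroup such that every element of $\Gamma\times\mathcal A$ can be written as a sum of (one or more) elements of $\Gamma\times\mathcal A$ in only finitely many ways. Let $V=\bigoplus_{(\alpha,a)\in\Gamma\times\mathcal A}V_{(\alpha,a)}$ be a $(\Gamma\times\mathcal A)$-graded complex vector space with finite-dimensional homogeneous subspaces, and suppose that a group $G$ acts linearly on $V$ preserving the gradation. Let $L=\bigoplus L_{(\alpha,a)}$ be the free Lie algebra generated by $V$, and let $\mathfrak L=\bigoplus\mathfrak L_{(\alpha,a)}$ be the free $\theta$-colored Lie superalgebra generated by $V$, where a $\theta$-colored Lie superalgebra has a graded bilinear bracket with $[x,y]=-\theta(a,b)[y,x]$ and $[x,[y,z]]=[[x,y],z]+\theta(a,b)[y,[x,z]]$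 for $x$, $y$ homogeneous of $\mathcal A$-degrees $a$, $b$ and all $z$. Both carry the $(\Gamma\times\mathcal A)$-gradation induced from $V$, and the action of $G$ extends to both by automorphisms preserving the gradation. Write $\operatorname{str}(g|\mathfrak L_{(\alpha,a)})=\psi(a)\operatorname{tr}(g|\mathfrak L_{(\alpha,a)})$ and $\operatorname{sdim}\mathfrak L_{(\alpha,a)}=\psi(a)\dim\mathfrak L_{(\alpha,a)}$. Then all $L_{(\alpha,a)}$ and $\mathfrak L_{(\alpha,a)}$ are finite-dimensional, and for all $g\in G$ and all $(\alpha,a)\in\Gamma\times\mathcal A$, $$\operatorname{str}(g|\mathfrak L_{(\alpha,a)})=\psi(a)\operatorname{tr}(g|L_{(\alpha,a)})+\sum_{\substack{(\beta,b)\in\Gamma\times\mathcal A\\ (\alpha,a)=2(\beta,b),\ b\text{ odd}}}\operatorname{tr}(g^2|L_{(\beta,b)}).$$ In particular (for $g=1$), $$\operatorname{sdim}\mathfrak L_{(\alpha,a)}=\psi(a)\dim L_{(\alpha,a)}+\sum_{\substack{(\beta,b)\in\Gamma\times\mathcal A\\ (\alpha,a)=2(\beta,b),\ b\text{ odd}}}\dim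 L_{(\beta,b)}.$$ -/

import Mathlib

/-- A coloring map on an abelian group `A`: a bimultiplicative map `θ : A × A → ℂˣ` with
`θ(a,b) θ(b,a) = 1`. -/
structure ColoringMap (A : Type*) [AddCommGroup A] where
  toFun : A → A → ℂˣ
  map_add_left : ∀ a b c, toFun (a + b) c = toFun a c * toFun b c
  map_add_right : ∀ a b c, toFun a (b + c) = toFun a b * toFun a c
  mul_swap : ∀ a b, toFun a b * toFun b a = 1

namespace ColoringMap

variable {A : Type*} [AddCommGroup A]

/-- The value `θ(a,b)` as a complex number. -/
def val (θ : ColoringMap A) (a b : A) : ℂ := (θ.toFun a b : ℂ)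

/-- The sign map `ψ(a) = θ(a,a)`, which takes the values `1` and `-1` only. -/
def sign (θ : ColoringMap A) (a : A) : ℂ := θ.val a a

theorem sign_eq (θ : ColoringMap A) (a : A) : θ.sign a = 1 ∨ θ.sign a = -1 := by
  have h := congrArg (fun u : ℂˣ => (u : ℂ)) (θ.mul_swap a a)
  simp only [Units.val_mul, Units.val_one] at h
  exact mul_self_eq_one_iff.mp h

/-- `a` is odd if `ψ(a) = -1`. -/
def IsOdd (θ : ColoringMap A) (a : A) : Prop := θ.sign a = -1

end ColoringMap

/-- Every element of the abelian semigroup `S` is the sum of a (nonempty, finite) sequence of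
elements of `S` in only finitely many ways. -/
def FiniteDecompositions (S : Type*) [AddCommSemigroup S] : Prop :=
  ∀ x : S, {w : FreeAddSemigroup S | FreeAddSemigroup.lift (id : S → S) w = x}.Finite

section Halves

variable {Γ A : Type*} [AddCommSemigroup Γ] [AddCommGroup A]

/-- The set of all `y = (β,b) ∈ Γ × A` with `x = 2y` and `b` odd. -/
def oddHalves (θ : ColoringMap A) (x : Γ × A) : Set (Γ × A) :=
  {y | y + y = x ∧ θ.IsOdd y.2}

theorem oddHalves_finite (hfin : FiniteDecompositions (Γ × A)) (θ : ColoringMap A) (x : Γ × A) :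
    (oddHalves θ x).Finite := by
  refine Set.Finite.of_finite_image (f := fun y => FreeAddSemigroup.of y + FreeAddSemigroup.of y)
    ((hfin x).subset ?_) ?_
  · rintro _ ⟨y, hy, rfl⟩
    simpa using hy.1
  · intro y _ z _ h
    exact congrArg FreeAddSemigroup.head h

end Halves

/-! ### Colored Lie superalgebras -/

section ColoredLie

variable {Γ A : Type*} [AddCommSemigroup Γ] [AddCommGroup A]

/-- The identities of a `(Γ × A)`-graded `θ`-colored Lie superalgebra, for a bracket `br` on a
space `M` with homogeneous subspaces `ℳ d`. -/
structure IsColoredLieBracket (θ : ColoringMap A) {M : Type*} [AddCommGroup M] [Module ℂ M]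
    (ℳ : Γ × A → Submodule ℂ M) (br : M →ₗ[ℂ] M →ₗ[ℂ] M) : Prop where
  graded : ∀ d e x y, x ∈ ℳ d → y ∈ ℳ e → br x y ∈ ℳ (d + e)
  skew : ∀ d e x y, x ∈ ℳ d → y ∈ ℳ e → br x y = -(θ.val d.2 e.2 • br y x)
  jacobi : ∀ d e x y z, x ∈ ℳ d → y ∈ ℳ e →
    br x (br y z) = br (br x y) z + θ.val d.2 e.2 • br y (br x z)

end ColoredLie

/-! ### The free colored Lie superalgebra generated by a graded space -/

namespace FreeLieSuperalgebra

variable {Γ A V : Type*} [AddCommSemigroup Γ] [AddCommGroup A] [AddCommGroup V] [Module ℂ V]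

/-- The free nonassociative algebra on the underlying set of `V`. -/
abbrev Pre (V : Type*) := FreeNonUnitalNonAssocAlgebra ℂ V

/-- The generator of the free nonassociative algebra that belongs to `v`. -/
noncomputable abbrev gen {V : Type*} (v : V) : Pre V := FreeNonUnitalNonAssocAlgebra.of ℂ v

/-- `IsMonomial 𝒱 d x`: `x` is a bracketed word in homogeneous elements of `V`, of total
degree `d`. -/
inductive IsMonomial (𝒱 : Γ × A → Submodule ℂ V) : Γ × A → Pre V → Prop
  | of (d : Γ × A) (v : V) (hv : v ∈ 𝒱 d) : IsMonomial 𝒱 d (gen v)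
  | mul (d e : Γ × A) (x y : Pre V) (hx : IsMonomial 𝒱 d x) (hy : IsMonomial 𝒱 e y) :
      IsMonomial 𝒱 (d + e) (x * y)

/-- The defining relators: linearity of the inclusion of `V`, colored skew-symmetry and the colored
Jacobi identity, closed under multiplication by arbitrary elements from either side. -/
inductive Relator (θ : ColoringMap A) (𝒱 : Γ × A → Submodule ℂ V) : Pre V → Prop
  | add (v w : V) : Relator θ 𝒱 (gen (v + w) - gen v - gen w)
  | smul (c : ℂ) (v : V) : Relator θ 𝒱 (gen (c • v) - c • gen v)
  | skew (d e : Γ × A) (x y : Pre V) (hx : IsMonomial 𝒱 d x) (hy : IsMonomial 𝒱 e y) :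
      Relator θ 𝒱 (x * y + θ.val d.2 e.2 • (y * x))
  | jacobi (d e : Γ × A) (x y z : Pre V) (hx : IsMonomial 𝒱 d x) (hy : IsMonomial 𝒱 e y) :
      Relator θ 𝒱 (x * (y * z) - x * y * z - θ.val d.2 e.2 • (y * (x * z)))
  | mul_left (x r : Pre V) (hr : Relator θ 𝒱 r) : Relator θ 𝒱 (x * r)
  | mul_right (x r : Pre V) (hr : Relator θ 𝒱 r) : Relator θ 𝒱 (r * x)

/-- The two-sided ideal generated by the relations. -/
noncomputable def relIdeal (θ : ColoringMap A) (𝒱 : Γ × A → Submodule ℂ V) : Submodule ℂ (Pre V) :=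
  Submodule.span ℂ {r | Relator θ 𝒱 r}

end FreeLieSuperalgebra

/-- The free `θ`-colored Lie superalgebra generated by the graded space `V = ⨁ d, 𝒱 d`. -/
abbrev FreeLieSuperalgebra {Γ A V : Type*} [AddCommSemigroup Γ] [AddCommGroup A] [AddCommGroup V]
    [Module ℂ V] (θ : ColoringMap A) (𝒱 : Γ × A → Submodule ℂ V) :=
  FreeLieSuperalgebra.Pre V ⧸ FreeLieSuperalgebra.relIdeal θ 𝒱

namespace FreeLieSuperalgebra

variable {Γ A V G : Type*} [AddCommSemigroup Γ] [AddCommGroup A] [AddCommGroup V] [Module ℂ V]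
  [Group G]

theorem mul_mem_left (θ : ColoringMap A) (𝒱 : Γ × A → Submodule ℂ V) (x r : Pre V)
    (hr : r ∈ relIdeal θ 𝒱) : x * r ∈ relIdeal θ 𝒱 := by
  have h : relIdeal θ 𝒱 ≤ (relIdeal θ 𝒱).comap (LinearMap.mulLeft ℂ x) := by
    refine Submodule.span_le.mpr fun r hr => ?_
    exact Submodule.subset_span (Relator.mul_left x r hr)
  exact h hr

theorem mul_mem_right (θ : ColoringMap A) (𝒱 : Γ × A → Submodule ℂ V) (x r : Pre V)
    (hr : r ∈ relIdeal θ 𝒱) : r * x ∈ relIdeal θ 𝒱 := by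
  have h : relIdeal θ 𝒱 ≤ (relIdeal θ 𝒱).comap (LinearMap.mulRight ℂ x) := by
    refine Submodule.span_le.mpr fun r hr => ?_
    exact Submodule.subset_span (Relator.mul_right x r hr)
  exact h hr

/-- The bracket, induced by the multiplication of the free nonassociative algebra. -/
noncomputable def bracket (θ : ColoringMap A) (𝒱 : Γ × A → Submodule ℂ V) :
    FreeLieSuperalgebra θ 𝒱 →ₗ[ℂ] FreeLieSuperalgebra θ 𝒱 →ₗ[ℂ] FreeLieSuperalgebra θ 𝒱 :=
  (relIdeal θ 𝒱).liftQ
    { toFun := fun x => (relIdeal θ 𝒱).mapQ (relIdeal θ 𝒱) (LinearMap.mulLeft ℂ x)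
        fun r hr => mul_mem_left θ 𝒱 x r hr
      map_add' := fun x y => by
        refine Submodule.linearMap_qext _ (LinearMap.ext fun z => ?_)
        exact congrArg (relIdeal θ 𝒱).mkQ (add_mul x y z)
      map_smul' := fun c x => by
        refine Submodule.linearMap_qext _ (LinearMap.ext fun z => ?_)
        exact congrArg (relIdeal θ 𝒱).mkQ (smul_mul_assoc c x z) }
    (fun r hr => by
      refine LinearMap.mem_ker.mpr (Submodule.linearMap_qext _ (LinearMap.ext fun z => ?_))
      exact (Submodule.Quotient.mk_eq_zero _).mpr (mul_mem_right θ 𝒱 z r hr))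

theorem bracket_mk (θ : ColoringMap A) (𝒱 : Γ × A → Submodule ℂ V) (x y : Pre V) :
    bracket θ 𝒱 ((relIdeal θ 𝒱).mkQ x) ((relIdeal θ 𝒱).mkQ y) = (relIdeal θ 𝒱).mkQ (x * y) :=
  rfl

/-- The inclusion of `V`. -/
noncomputable def ι (θ : ColoringMap A) (𝒱 : Γ × A → Submodule ℂ V) :
    V →ₗ[ℂ] FreeLieSuperalgebra θ 𝒱 where
  toFun v := (relIdeal θ 𝒱).mkQ (gen v)
  map_add' v w := by
    rw [← map_add, ← sub_eq_zero, ← map_sub]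
    refine (Submodule.Quotient.mk_eq_zero _).mpr (Submodule.subset_span ?_)
    have h := Relator.add (θ := θ) (𝒱 := 𝒱) v w
    rwa [sub_sub] at h
  map_smul' c v := by
    rw [RingHom.id_apply, ← map_smul, ← sub_eq_zero, ← map_sub]
    exact (Submodule.Quotient.mk_eq_zero _).mpr (Submodule.subset_span (Relator.smul c v))

/-- The homogeneous subspace of degree `d`, spanned by the bracketed words of degree `d`. -/
noncomputable def piece (θ : ColoringMap A) (𝒱 : Γ × A → Submodule ℂ V) (d : Γ × A) :
    Submodule ℂ (FreeLieSuperalgebra θ 𝒱) :=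
  (Submodule.span ℂ {x | IsMonomial 𝒱 d x}).map (relIdeal θ 𝒱).mkQ

theorem isColoredLieBracket (θ : ColoringMap A) (𝒱 : Γ × A → Submodule ℂ V) :
    IsColoredLieBracket θ (piece θ 𝒱) (bracket θ 𝒱) := by
  refine ⟨?_, ?_, ?_⟩
  · rintro d e _ _ ⟨x, hx, rfl⟩ ⟨y, hy, rfl⟩
    rw [bracket_mk]
    refine ⟨x * y, ?_, rfl⟩
    induction hx using Submodule.span_induction with
    | mem x hx =>
      induction hy using Submodule.span_induction with
      | mem y hy => exact Submodule.subset_span (IsMonomial.mul d e x y hx hy)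
      | zero => simp
      | add y z _ _ h1 h2 => rw [mul_add]; exact add_mem h1 h2
      | smul c y _ h => rw [mul_smul_comm]; exact Submodule.smul_mem _ c h
    | zero => simp
    | add x z _ _ h1 h2 => rw [add_mul]; exact add_mem h1 h2
    | smul c x _ h => rw [smul_mul_assoc]; exact Submodule.smul_mem _ c h
  · rintro d e _ _ ⟨x, hx, rfl⟩ ⟨y, hy, rfl⟩
    induction hx using Submodule.span_induction with
    | mem x hx =>
      induction hy using Submodule.span_induction with
      | mem y hy =>
        rw [bracket_mk, bracket_mk, ← add_eq_zero_iff_eq_neg, ← map_smul, ← map_add]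
        exact (Submodule.Quotient.mk_eq_zero _).mpr
          (Submodule.subset_span (Relator.skew d e x y hx hy))
      | zero => simp
      | add y z _ _ h1 h2 => simp only [map_add, LinearMap.add_apply, h1, h2, smul_add]; abel
      | smul c y _ h =>
        simp only [map_smul, LinearMap.smul_apply, h, smul_neg]
        rw [smul_comm]
    | zero => simp
    | add y z _ _ h1 h2 => simp only [map_add, LinearMap.add_apply, h1, h2, smul_add]; abel
    | smul c y _ h =>
      simp only [map_smul, LinearMap.smul_apply, h, smul_neg]
      rw [smul_comm]
  · rintro d e _ _ z ⟨x, hx, rfl⟩ ⟨y, hy, rfl⟩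
    obtain ⟨z, rfl⟩ := (relIdeal θ 𝒱).mkQ_surjective z
    induction hx using Submodule.span_induction with
    | mem x hx =>
      induction hy using Submodule.span_induction with
      | mem y hy =>
        simp only [bracket_mk]
        rw [← sub_eq_zero, ← map_smul, ← map_add, ← map_sub, ← sub_sub]
        exact (Submodule.Quotient.mk_eq_zero _).mpr
          (Submodule.subset_span (Relator.jacobi d e x y z hx hy))
      | zero => simp
      | add y z _ _ h1 h2 => simp only [map_add, LinearMap.add_apply, h1, h2, smul_add]; abel
      | smul c y _ h =>
        simp only [map_smul, LinearMap.smul_apply, h, smul_add]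
        rw [smul_comm]
    | zero => simp
    | add y z _ _ h1 h2 => simp only [map_add, LinearMap.add_apply, h1, h2, smul_add]; abel
    | smul c y _ h =>
      simp only [map_smul, LinearMap.smul_apply, h, smul_add]
      rw [smul_comm]

/-- Two linear maps which preserve brackets and agree on `V` are equal. -/
theorem linearMap_ext (θ : ColoringMap A) (𝒱 : Γ × A → Submodule ℂ V) {M : Type*} [AddCommGroup M]
    [Module ℂ M] (br : M →ₗ[ℂ] M →ₗ[ℂ] M) (E F : FreeLieSuperalgebra θ 𝒱 →ₗ[ℂ] M)
    (hE : ∀ x y, E (bracket θ 𝒱 x y) = br (E x) (E y))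
    (hF : ∀ x y, F (bracket θ 𝒱 x y) = br (F x) (F y))
    (h : ∀ v, E (ι θ 𝒱 v) = F (ι θ 𝒱 v)) : E = F := by
  have key : ∀ m : FreeMagma V, E ((relIdeal θ 𝒱).mkQ (MonoidAlgebra.single m 1)) =
      F ((relIdeal θ 𝒱).mkQ (MonoidAlgebra.single m 1)) := by
    intro m
    induction m with
    | ih1 v => exact h v
    | ih2 a b ha hb =>
      have hm : (MonoidAlgebra.single (a * b) 1 : Pre V) =
          MonoidAlgebra.single a 1 * MonoidAlgebra.single b 1 := by
        rw [MonoidAlgebra.single_mul_single, one_mul]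
      rw [hm, ← bracket_mk, hE, hF, ha, hb]
  ext m
  exact key m

section Lift

variable {M : Type*} [AddCommGroup M] [Module ℂ M]

/-- The nonassociative algebra structure on `M` given by the bilinear map `br`. -/
abbrev bracketSemiring (br : M →ₗ[ℂ] M →ₗ[ℂ] M) : NonUnitalNonAssocSemiring M where
  mul x y := br x y
  left_distrib x y z := map_add (br x) y z
  right_distrib x y z := LinearMap.map_add₂ br x y z
  zero_mul x := LinearMap.map_zero₂ br x
  mul_zero x := map_zero (br x)

/-- The linear extension of a map `j : V → M` to the free nonassociative algebra, products being
sent to brackets. -/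
noncomputable def preLift {W : Type*} (br : M →ₗ[ℂ] M →ₗ[ℂ] M) (j : W → M) : Pre W →ₗ[ℂ] M :=
  letI := bracketSemiring br
  haveI : IsScalarTower ℂ M M := ⟨fun c x y => LinearMap.map_smul₂ br c x y⟩
  haveI : SMulCommClass ℂ M M := ⟨fun c x y => ((br x).map_smul c y).symm⟩
  { toFun := FreeNonUnitalNonAssocAlgebra.lift ℂ j
    map_add' := map_add (FreeNonUnitalNonAssocAlgebra.lift ℂ j)
    map_smul' := map_smul (FreeNonUnitalNonAssocAlgebra.lift ℂ j) }

theorem preLift_gen {W : Type*} (br : M →ₗ[ℂ] M →ₗ[ℂ] M) (j : W → M) (v : W) :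
    preLift br j (gen v) = j v :=
  letI := bracketSemiring br
  haveI : IsScalarTower ℂ M M := ⟨fun c x y => LinearMap.map_smul₂ br c x y⟩
  haveI : SMulCommClass ℂ M M := ⟨fun c x y => ((br x).map_smul c y).symm⟩
  FreeNonUnitalNonAssocAlgebra.lift_of_apply ℂ j v

theorem preLift_mul {W : Type*} (br : M →ₗ[ℂ] M →ₗ[ℂ] M) (j : W → M) (x y : Pre W) :
    preLift br j (x * y) = br (preLift br j x) (preLift br j y) :=
  letI := bracketSemiring br
  haveI : IsScalarTower ℂ M M := ⟨fun c x y => LinearMap.map_smul₂ br c x y⟩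
  haveI : SMulCommClass ℂ M M := ⟨fun c x y => ((br x).map_smul c y).symm⟩
  map_mul (FreeNonUnitalNonAssocAlgebra.lift ℂ j) x y

variable {θ : ColoringMap A} {𝒱 : Γ × A → Submodule ℂ V} {ℳ : Γ × A → Submodule ℂ M}
  {br : M →ₗ[ℂ] M →ₗ[ℂ] M}

theorem preLift_isMonomial (h : IsColoredLieBracket θ ℳ br) (j : V →ₗ[ℂ] M)
    (hj : ∀ d, ∀ v ∈ 𝒱 d, j v ∈ ℳ d) {d : Γ × A} {x : Pre V} (hx : IsMonomial 𝒱 d x) :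
    preLift br j x ∈ ℳ d := by
  induction hx with
  | of d v hv => rw [preLift_gen]; exact hj d v hv
  | mul d e x y _ _ h1 h2 => rw [preLift_mul]; exact h.graded d e _ _ h1 h2

theorem preLift_relator (h : IsColoredLieBracket θ ℳ br) (j : V →ₗ[ℂ] M)
    (hj : ∀ d, ∀ v ∈ 𝒱 d, j v ∈ ℳ d) {r : Pre V} (hr : Relator θ 𝒱 r) : preLift br j r = 0 := by
  induction hr with
  | add v w => simp only [map_sub, preLift_gen, map_add]; abel
  | smul c v => simp only [map_sub, map_smul, preLift_gen, sub_self]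
  | skew d e x y hx hy =>
    rw [map_add, map_smul, preLift_mul, preLift_mul, add_eq_zero_iff_eq_neg]
    exact h.skew d e _ _ (preLift_isMonomial h j hj hx) (preLift_isMonomial h j hj hy)
  | jacobi d e x y z hx hy =>
    simp only [map_sub, map_smul, preLift_mul]
    rw [sub_sub, sub_eq_zero]
    exact h.jacobi d e _ _ _ (preLift_isMonomial h j hj hx) (preLift_isMonomial h j hj hy)
  | mul_left x r _ h0 => rw [preLift_mul, h0, map_zero]
  | mul_right x r _ h0 => rw [preLift_mul, h0, LinearMap.map_zero₂]

/-- The universal property: a degree-preserving linear map from `V` to a graded colored Lie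
superalgebra extends to a homomorphism (unique by `linearMap_ext`). -/
noncomputable def lift (h : IsColoredLieBracket θ ℳ br) (j : V →ₗ[ℂ] M)
    (hj : ∀ d, ∀ v ∈ 𝒱 d, j v ∈ ℳ d) : FreeLieSuperalgebra θ 𝒱 →ₗ[ℂ] M :=
  (relIdeal θ 𝒱).liftQ (preLift br j) (Submodule.span_le.mpr fun _ hr => preLift_relator h j hj hr)

theorem lift_ι (h : IsColoredLieBracket θ ℳ br) (j : V →ₗ[ℂ] M)
    (hj : ∀ d, ∀ v ∈ 𝒱 d, j v ∈ ℳ d) (v : V) : lift h j hj (ι θ 𝒱 v) = j v :=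
  preLift_gen br j v

theorem lift_bracket (h : IsColoredLieBracket θ ℳ br) (j : V →ₗ[ℂ] M)
    (hj : ∀ d, ∀ v ∈ 𝒱 d, j v ∈ ℳ d) (x y : FreeLieSuperalgebra θ 𝒱) :
    lift h j hj (bracket θ 𝒱 x y) = br (lift h j hj x) (lift h j hj y) := by
  obtain ⟨x, rfl⟩ := (relIdeal θ 𝒱).mkQ_surjective x
  obtain ⟨y, rfl⟩ := (relIdeal θ 𝒱).mkQ_surjective y
  exact preLift_mul br j x y

theorem lift_mem (h : IsColoredLieBracket θ ℳ br) (j : V →ₗ[ℂ] M)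
    (hj : ∀ d, ∀ v ∈ 𝒱 d, j v ∈ ℳ d) (d : Γ × A) (x : FreeLieSuperalgebra θ 𝒱)
    (hx : x ∈ piece θ 𝒱 d) : lift h j hj x ∈ ℳ d := by
  obtain ⟨x, hx, rfl⟩ := hx
  have hle : Submodule.span ℂ {x | IsMonomial 𝒱 d x} ≤ (ℳ d).comap (preLift br j) :=
    Submodule.span_le.mpr fun _ hy => preLift_isMonomial h j hj hy
  exact hle hx

end Lift

theorem ι_mem (θ : ColoringMap A) (𝒱 : Γ × A → Submodule ℂ V) (d : Γ × A) (v : V) (hv : v ∈ 𝒱 d) :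
    ι θ 𝒱 v ∈ piece θ 𝒱 d :=
  ⟨gen v, Submodule.subset_span (IsMonomial.of d v hv), rfl⟩

section Action

variable (θ : ColoringMap A) (𝒱 : Γ × A → Submodule ℂ V) (ρ : Representation ℂ G V)
  (hρ : ∀ g d, ∀ v ∈ 𝒱 d, ρ g v ∈ 𝒱 d)

/-- The action of `G` on the free colored Lie superalgebra by automorphisms which extends a
degree-preserving action of `G` on `V`. -/
noncomputable def rep : Representation ℂ G (FreeLieSuperalgebra θ 𝒱) where
  toFun g := lift (isColoredLieBracket θ 𝒱) (ι θ 𝒱 ∘ₗ ρ g)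
    (fun d v hv => ι_mem θ 𝒱 d _ (hρ g d v hv))
  map_one' := by
    refine linearMap_ext θ 𝒱 (bracket θ 𝒱) _ _ (lift_bracket _ _ _) (fun _ _ => rfl) fun v => ?_
    rw [lift_ι]
    simp
  map_mul' g k := by
    refine linearMap_ext θ 𝒱 (bracket θ 𝒱) _ _ (lift_bracket _ _ _) (fun x y => ?_) fun v => ?_
    · simp only [Module.End.mul_apply, lift_bracket]
    · simp only [Module.End.mul_apply, lift_ι, LinearMap.comp_apply, map_mul]

theorem rep_ι (g : G) (v : V) : rep θ 𝒱 ρ hρ g (ι θ 𝒱 v) = ι θ 𝒱 (ρ g v) :=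
  lift_ι (isColoredLieBracket θ 𝒱) (ι θ 𝒱 ∘ₗ ρ g)
    (fun d v hv => ι_mem θ 𝒱 d _ (hρ g d v hv)) v

theorem rep_bracket (g : G) (x y : FreeLieSuperalgebra θ 𝒱) :
    rep θ 𝒱 ρ hρ g (bracket θ 𝒱 x y) = bracket θ 𝒱 (rep θ 𝒱 ρ hρ g x) (rep θ 𝒱 ρ hρ g y) :=
  lift_bracket (isColoredLieBracket θ 𝒱) (ι θ 𝒱 ∘ₗ ρ g)
    (fun d v hv => ι_mem θ 𝒱 d _ (hρ g d v hv)) x y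

theorem rep_mem (g : G) (d : Γ × A) (x : FreeLieSuperalgebra θ 𝒱) (hx : x ∈ piece θ 𝒱 d) :
    rep θ 𝒱 ρ hρ g x ∈ piece θ 𝒱 d :=
  lift_mem (isColoredLieBracket θ 𝒱) (ι θ 𝒱 ∘ₗ ρ g)
    (fun d v hv => ι_mem θ 𝒱 d _ (hρ g d v hv)) d x hx

/-- The supertrace `str(g | 𝔏_d) = ψ(a) tr(g | 𝔏_d)`, where `d = (α,a)`. -/
noncomputable def str (g : G) (d : Γ × A) : ℂ :=
  θ.sign d.2 *
    LinearMap.trace ℂ (piece θ 𝒱 d) ((rep θ 𝒱 ρ hρ g).restrict (rep_mem θ 𝒱 ρ hρ g d))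

/-- The superdimension `sdim 𝔏_d = ψ(a) dim 𝔏_d`, where `d = (α,a)`. -/
noncomputable def sdim (d : Γ × A) : ℂ :=
  θ.sign d.2 * (Module.finrank ℂ (piece θ 𝒱 d) : ℂ)

end Action

end FreeLieSuperalgebra

/-! ### The free Lie algebra generated by a graded space -/

/-- The Lie ideal of the free Lie algebra on the underlying set of `V` whose quotient makes the
inclusion of `V` linear. -/
noncomputable def FreeLie.linIdeal (V : Type*) [AddCommGroup V] [Module ℂ V] :
    LieIdeal ℂ (FreeLieAlgebra ℂ V) :=
  LieSubmodule.lieSpan ℂ (FreeLieAlgebra ℂ V)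
    ({x | ∃ v w : V, x = FreeLieAlgebra.of ℂ (v + w) - FreeLieAlgebra.of ℂ v -
        FreeLieAlgebra.of ℂ w} ∪
      {x | ∃ (c : ℂ) (v : V), x = FreeLieAlgebra.of ℂ (c • v) - c • FreeLieAlgebra.of ℂ v})

/-- The free Lie algebra generated by the vector space `V`. -/
abbrev FreeLie (V : Type*) [AddCommGroup V] [Module ℂ V] :=
  FreeLieAlgebra ℂ V ⧸ FreeLie.linIdeal V

namespace FreeLie

variable {Γ A V G : Type*} [AddCommSemigroup Γ] [AddCommGroup A] [AddCommGroup V] [Module ℂ V]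
  [Group G]

/-- The quotient map, as a homomorphism of Lie algebras. -/
noncomputable def mk (V : Type*) [AddCommGroup V] [Module ℂ V] :
    FreeLieAlgebra ℂ V →ₗ⁅ℂ⁆ FreeLie V :=
  { (linIdeal V).toSubmodule.mkQ with map_lie' := fun {_ _} => rfl }

theorem mk_surjective : Function.Surjective (mk V) :=
  (linIdeal V).toSubmodule.mkQ_surjective

/-- The inclusion of `V`. -/
noncomputable def ι (V : Type*) [AddCommGroup V] [Module ℂ V] : V →ₗ[ℂ] FreeLie V where
  toFun v := mk V (FreeLieAlgebra.of ℂ v)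
  map_add' v w := by
    rw [← map_add, ← sub_eq_zero, ← map_sub]
    refine (Submodule.Quotient.mk_eq_zero _).mpr (LieSubmodule.subset_lieSpan (Or.inl ?_))
    exact ⟨v, w, (sub_sub _ _ _).symm⟩
  map_smul' c v := by
    rw [RingHom.id_apply, ← map_smul, ← sub_eq_zero, ← map_sub]
    exact (Submodule.Quotient.mk_eq_zero _).mpr
      (LieSubmodule.subset_lieSpan (Or.inr ⟨c, v, rfl⟩))

/-- Two Lie algebra homomorphisms which agree on `V` are equal. -/
theorem hom_ext {L : Type*} [LieRing L] [LieAlgebra ℂ L] (E F : FreeLie V →ₗ⁅ℂ⁆ L)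
    (h : ∀ v, E (ι V v) = F (ι V v)) : E = F := by
  have h1 : E.comp (mk V) = F.comp (mk V) := FreeLieAlgebra.hom_ext h
  ext x
  obtain ⟨x, rfl⟩ := mk_surjective x
  exact LieHom.congr_fun h1 x

/-- The universal property: a linear map from `V` to a Lie algebra extends to a homomorphism
(unique by `hom_ext`). -/
noncomputable def lift {L : Type*} [LieRing L] [LieAlgebra ℂ L] (j : V →ₗ[ℂ] L) :
    FreeLie V →ₗ⁅ℂ⁆ L :=
  { (linIdeal V).toSubmodule.liftQ (FreeLieAlgebra.lift ℂ j : FreeLieAlgebra ℂ V →ₗ⁅ℂ⁆ L).toLinearMap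
      (by
        have h : linIdeal V ≤ (FreeLieAlgebra.lift ℂ j : FreeLieAlgebra ℂ V →ₗ⁅ℂ⁆ L).ker := by
          refine LieSubmodule.lieSpan_le.mpr ?_
          rintro _ (⟨v, w, rfl⟩ | ⟨c, v, rfl⟩)
          · refine LieHom.mem_ker.mpr ?_
            simp
          · refine LieHom.mem_ker.mpr ?_
            simp
        intro x hx
        exact LieHom.mem_ker.mp (h hx)) with
    map_lie' := by
      intro x y
      obtain ⟨x, rfl⟩ := mk_surjective x
      obtain ⟨y, rfl⟩ := mk_surjective y
      exact LieHom.map_lie (FreeLieAlgebra.lift ℂ j : FreeLieAlgebra ℂ V →ₗ⁅ℂ⁆ L) x y }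

theorem lift_ι {L : Type*} [LieRing L] [LieAlgebra ℂ L] (j : V →ₗ[ℂ] L) (v : V) :
    lift j (ι V v) = j v :=
  FreeLieAlgebra.lift_of_apply (j : V → L) v

/-- `IsMonomial 𝒱 d x`: `x` is a bracketed word in homogeneous elements of `V`, of total
degree `d`. -/
inductive IsMonomial (𝒱 : Γ × A → Submodule ℂ V) : Γ × A → FreeLie V → Prop
  | of (d : Γ × A) (v : V) (hv : v ∈ 𝒱 d) : IsMonomial 𝒱 d (ι V v)
  | lie (d e : Γ × A) (x y : FreeLie V) (hx : IsMonomial 𝒱 d x) (hy : IsMonomial 𝒱 e y) :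
      IsMonomial 𝒱 (d + e) ⁅x, y⁆

/-- The homogeneous subspace of degree `d`, spanned by the bracketed words of degree `d`. -/
noncomputable def piece (𝒱 : Γ × A → Submodule ℂ V) (d : Γ × A) : Submodule ℂ (FreeLie V) :=
  Submodule.span ℂ {x | IsMonomial 𝒱 d x}

section Action

variable (𝒱 : Γ × A → Submodule ℂ V) (ρ : Representation ℂ G V)
  (hρ : ∀ g d, ∀ v ∈ 𝒱 d, ρ g v ∈ 𝒱 d)

/-- The action of `G` on the free Lie algebra by automorphisms which extends an action of `G`
on `V`. -/
noncomputable def rep : Representation ℂ G (FreeLie V) where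
  toFun g := (lift (ι V ∘ₗ ρ g)).toLinearMap
  map_one' := by
    have h : lift (ι V ∘ₗ ρ (1 : G)) = (LieHom.id : FreeLie V →ₗ⁅ℂ⁆ FreeLie V) :=
      hom_ext _ _ fun v => by rw [lift_ι]; simp
    rw [h]
    rfl
  map_mul' g k := by
    have h : lift (ι V ∘ₗ ρ (g * k)) = (lift (ι V ∘ₗ ρ g)).comp (lift (ι V ∘ₗ ρ k)) :=
      hom_ext _ _ fun v => by
        simp only [LieHom.comp_apply, lift_ι, LinearMap.comp_apply, map_mul, Module.End.mul_apply]
    rw [h]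
    rfl

theorem rep_ι (g : G) (v : V) : rep ρ g (ι V v) = ι V (ρ g v) :=
  lift_ι _ v

theorem rep_lie (g : G) (x y : FreeLie V) : rep ρ g ⁅x, y⁆ = ⁅rep ρ g x, rep ρ g y⁆ :=
  LieHom.map_lie (lift (ι V ∘ₗ ρ g)) x y

theorem rep_mem (hρ : ∀ g d, ∀ v ∈ 𝒱 d, ρ g v ∈ 𝒱 d) (g : G) (d : Γ × A) (x : FreeLie V) (hx : x ∈ piece 𝒱 d) :
    rep ρ g x ∈ piece 𝒱 d := by
  have hm : ∀ d x, IsMonomial 𝒱 d x → IsMonomial 𝒱 d (rep ρ g x) := by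
    intro d x hx
    induction hx with
    | of d v hv => rw [rep_ι]; exact IsMonomial.of d _ (hρ g d v hv)
    | lie d e x y _ _ h1 h2 => rw [rep_lie]; exact IsMonomial.lie d e _ _ h1 h2
  have hle : piece 𝒱 d ≤ (piece 𝒱 d).comap (rep ρ g) :=
    Submodule.span_le.mpr fun y hy => Submodule.subset_span (hm d y hy)
  exact hle hx

/-- The trace `tr(g | L_d)`. -/
noncomputable def tr (g : G) (d : Γ × A) : ℂ :=
  LinearMap.trace ℂ (piece 𝒱 d) ((rep ρ g).restrict (rep_mem 𝒱 ρ hρ g d))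

end Action

end FreeLie

/-! Both algebras are compared inside the free associative algebra whose letters form a homogeneous
basis of `V`. There they become spans of iterated colored commutators (`liePoly`). The ordinary free
Lie algebra is the case of the trivial coloring (`pieceEquiv`), so everything reduces to comparing
two colorings on the same letters.

The map `toWords` into the free associative algebra is injective on homogeneous subspaces by the
Dynkin–Specht–Wever theorem: right-normed bracketing multiplies a monomial of length `n` by `n`, for
every coloring. Dividing by `n` gives the left inverse `normDynkin` and the projection `lieProj`
onto Lie polynomials. Finite dimension follows, since each degree has finitely many words.

For the trace of `g`, choose the basis so that `g` is triangular. The trace is then the sum over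
words of the product of diagonal entries times the diagonal coefficient of `lieProj` (`trace_rep`).
Since `lieProj` respects every grading of the letters that determines their colors, the diagonal
entry may be made part of the degree, and summing the coefficients gives dimensions
(`sum_diagCoeff`). So the trace is a sum of `c` times the dimension of the Lie polynomials of degree
`d` and eigenvalue `c`, even if `g` is not diagonalizable.

It remains to compare dimensions, by Lazard elimination (`finrank_liePoly`). Removing a letter `x`
replaces the other letters `y` by all `ad(x)^k y` and splits off the line of `x`, together with the
line of `x² = ½[x,x]` if `x` is odd. Eliminate the same letters for both colorings. The surplus on
the colored side is one dimension in degree `2e` for each odd letter of degree `e`, and that letter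
adds one dimension to the ordinary Lie polynomials of degree `e`. This gives
`finrank_liePoly_eq_add_sum`. In the refined grading the halves of `(d, c)` are the pairs `(e, ν)`
with `2e = d` and `ν² = c`, so weighting by `c` produces the traces of `g²`. -/

namespace FreeColoredLie

variable {X : Type*}

/-! ### Words, colored commutators and Lie polynomials -/

/-- The monomial of the free associative algebra belonging to a word. -/
noncomputable def word (l : List X) : FreeAlgebra ℂ X := (l.map (FreeAlgebra.ι ℂ)).prod

@[simp] theorem word_nil : word ([] : List X) = 1 := rfl

@[simp] theorem word_cons (x : X) (l : List X) : word (x :: l) = FreeAlgebra.ι ℂ x * word l := by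
  simp [word]

theorem word_append (l k : List X) : word (l ++ k) = word l * word k := by
  simp [word]

/-- The basis of the free associative algebra consisting of the words. -/
noncomputable def wordBasis (X : Type*) : Module.Basis (List X) ℂ (FreeAlgebra ℂ X) :=
  (FreeAlgebra.basisFreeMonoid ℂ X).reindex FreeMonoid.toList

theorem wordBasis_apply (l : List X) : wordBasis X l = word l := by
  have h : FreeAlgebra.equivMonoidAlgebraFreeMonoid (R := ℂ) (word l) =
      MonoidAlgebra.single (FreeMonoid.ofList l) 1 := by
    induction l with
    | nil => simp; rfl
    | cons x l ih =>
      rw [word_cons, map_mul, ih]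
      simp [FreeAlgebra.equivMonoidAlgebraFreeMonoid, MonoidAlgebra.of_apply,
        MonoidAlgebra.single_mul_single]
  have h2 : FreeAlgebra.equivMonoidAlgebraFreeMonoid (R := ℂ) (wordBasis X l) =
      MonoidAlgebra.single (FreeMonoid.ofList l) 1 := by
    simp [wordBasis, FreeAlgebra.basisFreeMonoid]
  exact FreeAlgebra.equivMonoidAlgebraFreeMonoid.injective (h2.trans h.symm)

variable {A D : Type*} [AddCommGroup A] [AddCommMonoid D]

/-- The span of the nonempty words of degree `m`. -/
noncomputable def wordSpan (δ : X → D) (m : D) : Submodule ℂ (FreeAlgebra ℂ X) :=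
  Submodule.span ℂ (word '' {l | l ≠ [] ∧ (l.map δ).sum = m})

theorem mul_mem_wordSpan {δ : X → D} {d e : D} {u v : FreeAlgebra ℂ X} (hu : u ∈ wordSpan δ d)
    (hv : v ∈ wordSpan δ e) : u * v ∈ wordSpan δ (d + e) := by
  have h := Submodule.mul_mem_mul hu hv
  rw [wordSpan, wordSpan, Submodule.span_mul_span] at h
  refine Submodule.span_mono ?_ h
  rintro _ ⟨_, ⟨l, ⟨hl, rfl⟩, rfl⟩, _, ⟨k, ⟨hk, rfl⟩, rfl⟩, rfl⟩
  exact ⟨l ++ k, ⟨by simp [hl], by simp⟩, word_append l k⟩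

/-- The colored commutator of elements of degrees `d` and `e` of the free associative algebra. -/
noncomputable def comm (θ : ColoringMap A) (χ : D →+ A) (d e : D) {R : Type*} [Ring R] [Algebra ℂ R]
    (u v : R) : R :=
  u * v - θ.val (χ d) (χ e) • (v * u)

/-- Iterated colored commutators of letters. -/
inductive LieMon (θ : ColoringMap A) (χ : D →+ A) (δ : X → D) : D → FreeAlgebra ℂ X → Prop
  | of (x : X) : LieMon θ χ δ (δ x) (FreeAlgebra.ι ℂ x)
  | comm (d e : D) (u v : FreeAlgebra ℂ X) (hu : LieMon θ χ δ d u) (hv : LieMon θ χ δ e v) :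
      LieMon θ χ δ (d + e) (comm θ χ d e u v)

/-- The colored Lie polynomials of degree `m`. -/
noncomputable def liePoly (θ : ColoringMap A) (χ : D →+ A) (δ : X → D) (m : D) :
    Submodule ℂ (FreeAlgebra ℂ X) :=
  Submodule.span ℂ {u | LieMon θ χ δ m u}

section

variable (θ : ColoringMap A) (χ : D →+ A) (δ : X → D)

theorem ι_mem_wordSpan (x : X) : FreeAlgebra.ι ℂ x ∈ wordSpan δ (δ x) :=
  Submodule.subset_span ⟨[x], by simp, by simp⟩

theorem comm_mem_wordSpan {d e : D} {u v : FreeAlgebra ℂ X} (hu : u ∈ wordSpan δ d)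
    (hv : v ∈ wordSpan δ e) : comm θ χ d e u v ∈ wordSpan δ (d + e) := by
  refine sub_mem (mul_mem_wordSpan hu hv) (Submodule.smul_mem _ _ ?_)
  rw [add_comm]
  exact mul_mem_wordSpan hv hu

variable {θ χ δ} in
theorem LieMon.mem_wordSpan {m : D} {u : FreeAlgebra ℂ X} (h : LieMon θ χ δ m u) :
    u ∈ wordSpan δ m := by
  induction h with
  | of x => exact ι_mem_wordSpan δ x
  | comm d e u v _ _ hu hv => exact comm_mem_wordSpan θ χ δ hu hv

theorem liePoly_le_wordSpan (m : D) : liePoly θ χ δ m ≤ wordSpan δ m :=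
  Submodule.span_le.mpr fun _ h => LieMon.mem_wordSpan h

/-- The colored commutator as a bilinear map. -/
noncomputable def commₗ (d e : D) (R : Type*) [Ring R] [Algebra ℂ R] : R →ₗ[ℂ] R →ₗ[ℂ] R :=
  LinearMap.mul ℂ R - θ.val (χ d) (χ e) • (LinearMap.mul ℂ R).flip

theorem commₗ_apply (d e : D) {R : Type*} [Ring R] [Algebra ℂ R] (u v : R) :
    commₗ θ χ d e R u v = comm θ χ d e u v := rfl

/-- A bilinear map takes spans into a submodule if it does so for the spanning sets. -/
theorem bilin_mem_of_span {M N P : Type*} [AddCommGroup M] [Module ℂ M] [AddCommGroup N]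
    [Module ℂ N] [AddCommGroup P] [Module ℂ P] (f : M →ₗ[ℂ] N →ₗ[ℂ] P) {s : Set M} {t : Set N}
    {p : Submodule ℂ P} (h : ∀ x ∈ s, ∀ y ∈ t, f x y ∈ p) {x : M} {y : N}
    (hx : x ∈ Submodule.span ℂ s) (hy : y ∈ Submodule.span ℂ t) : f x y ∈ p := by
  have h1 : ∀ x ∈ s, Submodule.span ℂ t ≤ p.comap (f x) := fun x hx =>
    Submodule.span_le.mpr fun y hy => h x hx y hy
  have h2 : Submodule.span ℂ s ≤ p.comap (f.flip y) :=
    Submodule.span_le.mpr fun x hx => h1 x hx hy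
  exact h2 hx

theorem comm_mem_liePoly {d e : D} {u v : FreeAlgebra ℂ X} (hu : u ∈ liePoly θ χ δ d)
    (hv : v ∈ liePoly θ χ δ e) : comm θ χ d e u v ∈ liePoly θ χ δ (d + e) :=
  bilin_mem_of_span (commₗ θ χ d e _)
    (fun u hu v hv => Submodule.subset_span (LieMon.comm d e u v hu hv)) hu hv

theorem ι_mem_liePoly (x : X) : FreeAlgebra.ι ℂ x ∈ liePoly θ χ δ (δ x) :=
  Submodule.subset_span (LieMon.of x)

end

theorem _root_.ColoringMap.val_add_left (θ : ColoringMap A) (a b c : A) :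
    θ.val (a + b) c = θ.val a c * θ.val b c := by
  simp [ColoringMap.val, θ.map_add_left]

theorem _root_.ColoringMap.val_add_right (θ : ColoringMap A) (a b c : A) :
    θ.val a (b + c) = θ.val a b * θ.val a c := by
  simp [ColoringMap.val, θ.map_add_right]

theorem _root_.ColoringMap.val_mul_swap (θ : ColoringMap A) (a b : A) :
    θ.val a b * θ.val b a = 1 := by
  simp [ColoringMap.val, ← Units.val_mul, θ.mul_swap]

section

variable (θ : ColoringMap A) (χ : D →+ A) {R : Type*} [Ring R] [Algebra ℂ R]

theorem comm_skew (d e : D) (u v : R) :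
    comm θ χ d e u v = -(θ.val (χ d) (χ e) • comm θ χ e d v u) := by
  simp only [comm, smul_sub, smul_smul, θ.val_mul_swap, one_smul]
  abel

/-- A formal identity in any associative algebra: the degrees enter only through the values of `θ`,
so `u`, `v`, `w` need not be homogeneous. -/
theorem comm_jacobi (d e f : D) (u v w : R) :
    comm θ χ d (e + f) u (comm θ χ e f v w) =
      comm θ χ (d + e) f (comm θ χ d e u v) w +
        θ.val (χ d) (χ e) • comm θ χ e (d + f) v (comm θ χ d f u w) := by
  simp only [comm, map_add, θ.val_add_left, θ.val_add_right, mul_sub, sub_mul, smul_sub,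
    mul_smul_comm, smul_mul_assoc, smul_smul, mul_assoc]
  have h := θ.val_mul_swap (χ d) (χ e)
  have h1 : θ.val (χ d) (χ e) * (θ.val (χ e) (χ d) * θ.val (χ e) (χ f)) = θ.val (χ e) (χ f) := by
    rw [← mul_assoc, h, one_mul]
  have h2 : θ.val (χ d) (χ e) * (θ.val (χ e) (χ d) * (θ.val (χ e) (χ f) * θ.val (χ d) (χ f))) =
      θ.val (χ d) (χ f) * θ.val (χ e) (χ f) := by
    rw [← mul_assoc, h, one_mul, mul_comm]
  simp only [h1, h2]
  module

theorem comm_map {S : Type*} [Ring S] [Algebra ℂ S] (f : R →ₐ[ℂ] S) (d e : D) (u v : R) :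
    f (comm θ χ d e u v) = comm θ χ d e (f u) (f v) := by
  simp [comm]

end

end FreeColoredLie

namespace FreeColoredLie

variable {A D X : Type*} [AddCommGroup A] [AddCommMonoid D]

/-! ### Lazard elimination of one letter -/

section Elimination

variable (θ : ColoringMap A) (χ : D →+ A) (δ : X → D) (x : X)

/-- The letters which remain after elimination of the letter `x`: the pair `(y, k)` stands for the
`k`-fold commutator of `x` with `y`. -/
abbrev ElimLetter (x : X) := {y : X // y ≠ x} × ℕ

/-- The degree of a letter after elimination. -/
def elimDeg (p : ElimLetter x) : D := p.2 • δ x + δ p.1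

/-- The `k`-fold colored commutator of `x` with `y`. -/
noncomputable def adPow (y : X) : ℕ → FreeAlgebra ℂ X
  | 0 => FreeAlgebra.ι ℂ y
  | k + 1 => comm θ χ (δ x) (k • δ x + δ y) (FreeAlgebra.ι ℂ x) (adPow y k)

/-- The embedding of the free algebra on the remaining letters. -/
noncomputable def elimHom : FreeAlgebra ℂ (ElimLetter x) →ₐ[ℂ] FreeAlgebra ℂ X :=
  FreeAlgebra.lift ℂ fun p => adPow θ χ δ x p.1 p.2

/-- Multiplication by a remaining letter, on `T(Y) ⊗ ℂ[x]`. -/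
noncomputable def letterOp (p : ElimLetter x) :
    Module.End ℂ (List (ElimLetter x) × ℕ →₀ ℂ) :=
  Finsupp.lmapDomain ℂ ℂ fun q => (p :: q.1, q.2)

/-- Multiplication of a basis element by the eliminated letter, on `T(Y) ⊗ ℂ[x]`. -/
noncomputable def elimOpAux : List (ElimLetter x) → ℕ → (List (ElimLetter x) × ℕ →₀ ℂ)
  | [], k => Finsupp.single ([], k + 1) 1
  | p :: u, k => Finsupp.single ((p.1, p.2 + 1) :: u, k) 1 +
      θ.val (χ (δ x)) (χ (elimDeg δ x p)) • letterOp x p (elimOpAux u k)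

/-- Multiplication by the eliminated letter, on `T(Y) ⊗ ℂ[x]`. -/
noncomputable def elimOp : Module.End ℂ (List (ElimLetter x) × ℕ →₀ ℂ) :=
  Finsupp.linearCombination ℂ fun q => elimOpAux θ χ δ x q.1 q.2

theorem letterOp_single (p : ElimLetter x) (u : List (ElimLetter x)) (k : ℕ) (c : ℂ) :
    letterOp x p (Finsupp.single (u, k) c) = Finsupp.single (p :: u, k) c := by
  simp [letterOp]

/-- The relation `x p = [x, p] + θ(x, p) p x`, where `[x, p]` is again a letter. The recursion in
`elimOpAux` is designed to force it. -/
theorem elimOp_mul_letterOp (p : ElimLetter x) :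
    elimOp θ χ δ x * letterOp x p = letterOp x (p.1, p.2 + 1) +
      θ.val (χ (δ x)) (χ (elimDeg δ x p)) • (letterOp x p * elimOp θ χ δ x) := by
  refine Finsupp.lhom_ext' fun q => LinearMap.ext_ring ?_
  obtain ⟨u, k⟩ := q
  simp [letterOp_single, elimOp, elimOpAux]

open Classical in
/-- The action of the free algebra on `T(Y) ⊗ ℂ[x]`. -/
noncomputable def elimRep :
    FreeAlgebra ℂ X →ₐ[ℂ] Module.End ℂ (List (ElimLetter x) × ℕ →₀ ℂ) :=
  FreeAlgebra.lift ℂ fun z => if h : z = x then elimOp θ χ δ x else letterOp x (⟨z, h⟩, 0)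

theorem elimRep_self : elimRep θ χ δ x (FreeAlgebra.ι ℂ x) = elimOp θ χ δ x := by
  simp [elimRep]

/-- By `elimOp_mul_letterOp`, the colored commutator of `x` with the letter `(y, k)` acts as the
letter `(y, k + 1)`. Hence words in the new letters act freely, which makes the new letters
algebraically independent. -/
theorem elimRep_adPow (y : {y : X // y ≠ x}) (k : ℕ) :
    elimRep θ χ δ x (adPow θ χ δ x y k) = letterOp x (y, k) := by
  induction k with
  | zero => simp [adPow, elimRep, y.2]
  | succ k ih =>
    have h := comm_map (S := Module.End ℂ (List (ElimLetter x) × ℕ →₀ ℂ)) θ χ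
      (elimRep θ χ δ x) (δ x) (k • δ x + δ y) (FreeAlgebra.ι ℂ x)
      (adPow θ χ δ x y k)
    refine h.trans ?_
    rw [ih, elimRep_self, comm, elimOp_mul_letterOp]
    exact add_sub_cancel_right (G := Module.End ℂ (List (ElimLetter x) × ℕ →₀ ℂ)) _ _

theorem elimRep_elimHom_word (u v : List (ElimLetter x)) (k : ℕ) :
    elimRep θ χ δ x (elimHom θ χ δ x (word u)) (Finsupp.single (v, k) 1) =
      Finsupp.single (u ++ v, k) 1 := by
  induction u with
  | nil => simp
  | cons p u ih =>
    rw [word_cons, map_mul, map_mul, Module.End.mul_apply, ih, elimHom, FreeAlgebra.lift_ι_apply,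
      elimRep_adPow, letterOp_single, List.cons_append]

/-- Evaluation of the action at the unit. -/
noncomputable def elimEval : FreeAlgebra ℂ X →ₗ[ℂ] (List (ElimLetter x) × ℕ →₀ ℂ) :=
  (LinearMap.applyₗ (Finsupp.single ([], 0) 1)) ∘ₗ (elimRep θ χ δ x).toLinearMap

theorem elimEval_elimHom_word (u : List (ElimLetter x)) :
    elimEval θ χ δ x (elimHom θ χ δ x (word u)) = Finsupp.single (u, 0) 1 := by
  simpa [elimEval] using elimRep_elimHom_word θ χ δ x u [] 0

theorem elimEval_ι_self : elimEval θ χ δ x (FreeAlgebra.ι ℂ x) = Finsupp.single ([], 1) 1 := by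
  simp [elimEval, elimRep_self, elimOp, elimOpAux]

theorem elimEval_ι_self_sq : elimEval θ χ δ x (FreeAlgebra.ι ℂ x * FreeAlgebra.ι ℂ x) =
    Finsupp.single ([], 2) 1 := by
  simp [elimEval, elimRep_self, elimOp, elimOpAux]

theorem elimEval_elimHom (t : FreeAlgebra ℂ (ElimLetter x)) :
    elimEval θ χ δ x (elimHom θ χ δ x t) =
      Finsupp.lmapDomain ℂ ℂ (fun u => (u, 0)) ((wordBasis _).repr t) := by
  suffices h : elimEval θ χ δ x ∘ₗ (elimHom θ χ δ x).toLinearMap =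
      Finsupp.lmapDomain ℂ ℂ (fun u => (u, 0)) ∘ₗ (wordBasis _).repr.toLinearMap from
    LinearMap.congr_fun h t
  refine (wordBasis _).ext fun u => ?_
  simp only [LinearMap.comp_apply, LinearEquiv.coe_coe, Module.Basis.repr_self]
  rw [wordBasis_apply]
  simp [elimEval_elimHom_word]

theorem elimHom_injective : Function.Injective (elimHom θ χ δ x) := by
  intro s t h
  have h1 := congrArg (elimEval θ χ δ x) h
  rw [elimEval_elimHom, elimEval_elimHom] at h1
  exact (wordBasis _).repr.injective
    (Finsupp.mapDomain_injective (fun u v h => congrArg Prod.fst h) h1)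

/-- Coordinates with a positive power of `x` detect what lies outside the subalgebra of the
remaining letters; they will separate `x` and `x²` from it. -/
theorem elimEval_elimHom_apply (t : FreeAlgebra ℂ (ElimLetter x)) (u : List (ElimLetter x))
    (k : ℕ) : elimEval θ χ δ x (elimHom θ χ δ x t) (u, k + 1) = 0 := by
  rw [elimEval_elimHom, Finsupp.lmapDomain_apply]
  refine Finsupp.mapDomain_of_notMem_range _ _ ?_
  rintro ⟨v, h⟩
  simpa using congrArg Prod.snd h

/-! #### The Lie polynomials -/

theorem adPow_mem (y : X) (k : ℕ) :
    LieMon θ χ δ (k • δ x + δ y) (adPow θ χ δ x y k) := by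
  induction k with
  | zero => simpa [adPow] using LieMon.of y
  | succ k ih =>
    have h := LieMon.comm _ _ _ _ (LieMon.of (θ := θ) (χ := χ) (δ := δ) x) ih
    rwa [← add_assoc, ← succ_nsmul'] at h

theorem LieMon.elimHom {m : D} {u : FreeAlgebra ℂ (ElimLetter x)}
    (h : LieMon θ χ (elimDeg δ x) m u) : LieMon θ χ δ m (elimHom θ χ δ x u) := by
  induction h with
  | of p =>
    rw [FreeColoredLie.elimHom, FreeAlgebra.lift_ι_apply]
    exact adPow_mem θ χ δ x p.1 p.2
  | comm d e u v _ _ hu hv => rw [comm_map]; exact LieMon.comm d e _ _ hu hv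

/-- The image of the Lie polynomials in the remaining letters. -/
noncomputable def elimLie (m : D) : Submodule ℂ (FreeAlgebra ℂ X) :=
  (liePoly θ χ (elimDeg δ x) m).map (elimHom θ χ δ x).toLinearMap

theorem elimLie_eq_span (m : D) : elimLie θ χ δ x m =
    Submodule.span ℂ (elimHom θ χ δ x '' {u | LieMon θ χ (elimDeg δ x) m u}) := by
  rw [elimLie, liePoly, Submodule.map_span]
  rfl

theorem comm_mem_elimLie {d e : D} {u v : FreeAlgebra ℂ X} (hu : u ∈ elimLie θ χ δ x d)
    (hv : v ∈ elimLie θ χ δ x e) : comm θ χ d e u v ∈ elimLie θ χ δ x (d + e) := by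
  obtain ⟨u, hu, rfl⟩ := hu
  obtain ⟨v, hv, rfl⟩ := hv
  exact ⟨comm θ χ d e u v, comm_mem_liePoly θ χ _ hu hv, comm_map θ χ _ d e u v⟩

/-- The operator `ad x` is a colored derivation that shifts the letter `(y, k)` to `(y, k + 1)`, so
it preserves the Lie polynomials in the remaining letters. -/
theorem comm_self_mem_elimLie {e : D} {v : FreeAlgebra ℂ X} (hv : v ∈ elimLie θ χ δ x e) :
    comm θ χ (δ x) e (FreeAlgebra.ι ℂ x) v ∈ elimLie θ χ δ x (δ x + e) := by
  rw [elimLie_eq_span] at hv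
  suffices h : Submodule.span ℂ (elimHom θ χ δ x '' {u | LieMon θ χ (elimDeg δ x) e u}) ≤
      (elimLie θ χ δ x (δ x + e)).comap (commₗ θ χ (δ x) e _ (FreeAlgebra.ι ℂ x)) from h hv
  refine Submodule.span_le.mpr ?_
  rintro _ ⟨w, hw, rfl⟩
  change comm θ χ (δ x) e (FreeAlgebra.ι ℂ x) (elimHom θ χ δ x w) ∈ elimLie θ χ δ x (δ x + e)
  clear hv
  induction hw with
  | of p =>
    refine ⟨FreeAlgebra.ι ℂ (p.1, p.2 + 1), ?_, ?_⟩
    · have h := ι_mem_liePoly θ χ (elimDeg δ x) (p.1, p.2 + 1)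
      rwa [elimDeg, succ_nsmul', add_assoc] at h
    · simp only [AlgHom.toLinearMap_apply, elimHom, FreeAlgebra.lift_ι_apply]
      rfl
  | comm d e u v hu hv h1 h2 =>
    rw [comm_map, comm_jacobi]
    have hu' : elimHom θ χ δ x u ∈ elimLie θ χ δ x d := ⟨u, Submodule.subset_span hu, rfl⟩
    have hv' : elimHom θ χ δ x v ∈ elimLie θ χ δ x e := ⟨v, Submodule.subset_span hv, rfl⟩
    refine add_mem ?_ (Submodule.smul_mem _ _ ?_)
    · rw [← add_assoc]
      exact comm_mem_elimLie θ χ δ x h1 hv'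
    · rw [add_left_comm]
      exact comm_mem_elimLie θ χ δ x hu' h2

/-- The spanning set of the Lie polynomials obtained by elimination of `x`. -/
inductive ElimSpan : D → FreeAlgebra ℂ X → Prop
  | base {m : D} {u : FreeAlgebra ℂ X} (h : u ∈ elimLie θ χ δ x m) : ElimSpan m u
  | self : ElimSpan (δ x) (FreeAlgebra.ι ℂ x)
  | sq (h : θ.IsOdd (χ (δ x))) :
      ElimSpan (δ x + δ x) (FreeAlgebra.ι ℂ x * FreeAlgebra.ι ℂ x)

/-- The elimination span is closed under commutators because `[x, x]` is `0` or `2x²` according to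
the parity of `x`, and for odd `x` the square commutes with `x` and with itself and satisfies `[x²,
v] = [x, [x, v]]`. -/
theorem comm_elimSpan {d e : D} {u v : FreeAlgebra ℂ X} (hu : ElimSpan θ χ δ x d u)
    (hv : ElimSpan θ χ δ x e v) :
    comm θ χ d e u v ∈ Submodule.span ℂ {w | ElimSpan θ χ δ x (d + e) w} := by
  have hbase : ∀ {m w}, w ∈ elimLie θ χ δ x m →
      w ∈ Submodule.span ℂ {w | ElimSpan θ χ δ x m w} := fun h =>
    Submodule.subset_span (ElimSpan.base h)
  have hswap : ∀ {d e u v}, comm θ χ d e u v ∈ Submodule.span ℂ {w | ElimSpan θ χ δ x (d + e) w} →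
      comm θ χ e d v u ∈ Submodule.span ℂ {w | ElimSpan θ χ δ x (e + d) w} := by
    intro d e u v h
    rw [comm_skew, add_comm]
    exact neg_mem (Submodule.smul_mem _ _ h)
  have hsq : ∀ {e v}, θ.IsOdd (χ (δ x)) → v ∈ elimLie θ χ δ x e →
      comm θ χ (δ x + δ x) e (FreeAlgebra.ι ℂ x * FreeAlgebra.ι ℂ x) v ∈
        Submodule.span ℂ {w | ElimSpan θ χ δ x (δ x + δ x + e) w} := by
    intro e v ho hv
    -- For odd `x` the mixed terms of `[x, [x, v]]` cancel, leaving `[x², v]`.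
    have h := comm_self_mem_elimLie θ χ δ x (comm_self_mem_elimLie θ χ δ x hv)
    refine hbase ?_
    rw [add_assoc]
    convert h using 1
    have ho : θ.val (χ (δ x)) (χ (δ x)) = -1 := ho
    simp only [comm, map_add, θ.val_add_left, θ.val_add_right, ho, mul_sub, sub_mul, smul_sub,
      mul_smul_comm, smul_mul_assoc, smul_smul, mul_assoc]
    module
  rcases hu with hu | _ | ho <;> rcases hv with hv | _ | ho'
  · exact hbase (comm_mem_elimLie θ χ δ x hu hv)
  · exact hswap (hbase (comm_self_mem_elimLie θ χ δ x hu))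
  · exact hswap (hsq ho' hu)
  · exact hbase (comm_self_mem_elimLie θ χ δ x hv)
  · rcases θ.sign_eq (χ (δ x)) with h | h
    · have h : θ.val (χ (δ x)) (χ (δ x)) = 1 := h
      simp [comm, h]
    · refine sub_mem ?_ (Submodule.smul_mem _ _ ?_) <;>
        exact Submodule.subset_span (ElimSpan.sq h)
  · have ho : θ.val (χ (δ x)) (χ (δ x)) = -1 := ho'
    simp [comm, θ.val_add_right, ho, mul_assoc]
  · exact hsq ho hv
  · have ho : θ.val (χ (δ x)) (χ (δ x)) = -1 := ho
    simp [comm, θ.val_add_left, ho, mul_assoc]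
  · have ho : θ.val (χ (δ x)) (χ (δ x)) = -1 := ho
    simp [comm, θ.val_add_left, θ.val_add_right, ho]

theorem liePoly_eq_span_elimSpan (m : D) :
    liePoly θ χ δ m = Submodule.span ℂ {w | ElimSpan θ χ δ x m w} := by
  apply le_antisymm
  · refine Submodule.span_le.mpr fun u hu => ?_
    change LieMon θ χ δ m u at hu
    induction hu with
    | of z =>
      refine Submodule.subset_span ?_
      by_cases h : z = x
      · rw [h]
        exact ElimSpan.self
      · refine ElimSpan.base ⟨FreeAlgebra.ι ℂ (⟨z, h⟩, 0), ?_, ?_⟩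
        · simpa [elimDeg] using ι_mem_liePoly θ χ (elimDeg δ x) (⟨z, h⟩, 0)
        · simp [elimHom, adPow]
    | comm d e u v _ _ hu hv =>
      exact bilin_mem_of_span (commₗ θ χ d e _)
        (fun u hu v hv => comm_elimSpan θ χ δ x hu hv) hu hv
  · refine Submodule.span_le.mpr fun u hu => ?_
    rcases hu with hu | _ | ho
    · rw [elimLie_eq_span] at hu
      refine Submodule.span_mono ?_ hu
      rintro _ ⟨w, hw, rfl⟩
      exact LieMon.elimHom θ χ δ x hw
    · exact ι_mem_liePoly θ χ δ x
    · have h := comm_mem_liePoly θ χ δ (ι_mem_liePoly θ χ δ x) (ι_mem_liePoly θ χ δ x)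
      have ho : θ.val (χ (δ x)) (χ (δ x)) = -1 := ho
      have h2 := Submodule.smul_mem _ (2⁻¹ : ℂ) h
      rw [comm, ho] at h2
      -- For odd `x` the square is half the colored commutator of `x` with itself.
      have h3 : FreeAlgebra.ι ℂ x * FreeAlgebra.ι ℂ x = (2⁻¹ : ℂ) •
          (FreeAlgebra.ι ℂ x * FreeAlgebra.ι ℂ x -
            (-1 : ℂ) • (FreeAlgebra.ι ℂ x * FreeAlgebra.ι ℂ x)) := by module
      rw [h3]
      exact h2

open Classical in
theorem liePoly_eq_sup (m : D) : liePoly θ χ δ m = (elimLie θ χ δ x m ⊔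
    (if δ x = m then Submodule.span ℂ {FreeAlgebra.ι ℂ x} else ⊥)) ⊔
    (if δ x + δ x = m ∧ θ.IsOdd (χ (δ x)) then
      Submodule.span ℂ {FreeAlgebra.ι ℂ x * FreeAlgebra.ι ℂ x} else ⊥) := by
  rw [liePoly_eq_span_elimSpan θ χ δ x]
  apply le_antisymm
  · refine Submodule.span_le.mpr fun u hu => ?_
    rcases hu with hu | _ | ho
    · exact Submodule.mem_sup_left (Submodule.mem_sup_left hu)
    · refine Submodule.mem_sup_left (Submodule.mem_sup_right ?_)
      rw [if_pos rfl]
      exact Submodule.mem_span_singleton_self _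
    · refine Submodule.mem_sup_right ?_
      rw [if_pos ⟨rfl, ho⟩]
      exact Submodule.mem_span_singleton_self _
  · refine sup_le (sup_le (fun u hu => Submodule.subset_span (ElimSpan.base hu)) ?_) ?_
    · split_ifs with h
      · subst h
        exact Submodule.span_mono (Set.singleton_subset_iff.mpr ElimSpan.self)
      · exact bot_le
    · split_ifs with h
      · obtain ⟨rfl, h⟩ := h
        exact Submodule.span_mono (Set.singleton_subset_iff.mpr (ElimSpan.sq h))
      · exact bot_le

theorem finiteDimensional_wordSpan {m : D} (hm : {l : List X | l ≠ [] ∧ (l.map δ).sum = m}.Finite) :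
    FiniteDimensional ℂ (wordSpan δ m) :=
  FiniteDimensional.span_of_finite ℂ (hm.image word)

theorem finrank_ite_span_singleton {M : Type*} [AddCommGroup M] [Module ℂ M] (p : Prop) [Decidable p]
    {v : M} (hv : v ≠ 0) :
    Module.finrank ℂ (if p then Submodule.span ℂ {v} else ⊥ : Submodule ℂ M) = if p then 1 else 0 := by
  by_cases h : p
  · rw [if_pos h, if_pos h, finrank_span_singleton hv]
  · rw [if_neg h, if_neg h, finrank_bot]

-- The sum in `liePoly_eq_sup` is direct: under `elimEval` the three summands are told apart by the
-- coordinates of `x` and `x²`. The first summand keeps its dimension because `elimHom` is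
-- injective.
open Classical in
theorem finrank_liePoly {m : D} (hm : {l : List X | l ≠ [] ∧ (l.map δ).sum = m}.Finite) :
    Module.finrank ℂ (liePoly θ χ δ m) = Module.finrank ℂ (liePoly θ χ (elimDeg δ x) m) +
      (if δ x = m then 1 else 0) + (if δ x + δ x = m ∧ θ.IsOdd (χ (δ x)) then 1 else 0) := by
  have hfin : FiniteDimensional ℂ (liePoly θ χ δ m) :=
    haveI := finiteDimensional_wordSpan δ hm
    Submodule.finiteDimensional_of_le (liePoly_le_wordSpan θ χ δ m)
  set a := elimLie θ χ δ x m with ha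
  set b : Submodule ℂ (FreeAlgebra ℂ X) :=
    if δ x = m then Submodule.span ℂ {FreeAlgebra.ι ℂ x} else ⊥ with hb
  set c : Submodule ℂ (FreeAlgebra ℂ X) := if δ x + δ x = m ∧ θ.IsOdd (χ (δ x)) then
      Submodule.span ℂ {FreeAlgebra.ι ℂ x * FreeAlgebra.ι ℂ x} else ⊥ with hc
  have hsup : liePoly θ χ δ m = (a ⊔ b) ⊔ c := liePoly_eq_sup θ χ δ x m
  have hab : FiniteDimensional ℂ (a ⊔ b : Submodule ℂ (FreeAlgebra ℂ X)) :=
    Submodule.finiteDimensional_of_le (le_sup_left.trans hsup.ge)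
  have hfa : FiniteDimensional ℂ a := Submodule.finiteDimensional_of_le (le_sup_left.trans
    (le_sup_left.trans hsup.ge))
  have hfb : FiniteDimensional ℂ b := Submodule.finiteDimensional_of_le (le_sup_right.trans
    (le_sup_left.trans hsup.ge))
  have hfc : FiniteDimensional ℂ c := Submodule.finiteDimensional_of_le (le_sup_right.trans
    hsup.ge)
  have hvan : ∀ t ∈ a, ∀ k, elimEval θ χ δ x t ([], k + 1) = 0 := by
    rintro _ ⟨t, _, rfl⟩ k
    exact elimEval_elimHom_apply θ χ δ x t [] k
  have hb' : ∀ t ∈ b, ∃ s : ℂ, t = s • FreeAlgebra.ι ℂ x := by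
    intro t ht
    rw [hb] at ht
    split_ifs at ht
    · obtain ⟨s, rfl⟩ := Submodule.mem_span_singleton.mp ht
      exact ⟨s, rfl⟩
    · exact ⟨0, by simpa using ht⟩
  have hc' : ∀ t ∈ c, ∃ s : ℂ, t = s • (FreeAlgebra.ι ℂ x * FreeAlgebra.ι ℂ x) := by
    intro t ht
    rw [hc] at ht
    split_ifs at ht
    · obtain ⟨s, rfl⟩ := Submodule.mem_span_singleton.mp ht
      exact ⟨s, rfl⟩
    · exact ⟨0, by simpa using ht⟩
  have h1 : Disjoint a b := by
    refine Submodule.disjoint_def.mpr fun t hta htb => ?_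
    obtain ⟨s, rfl⟩ := hb' t htb
    have h := hvan _ hta 0
    rw [map_smul, elimEval_ι_self] at h
    simp at h
    simp [h]
  have h2 : Disjoint (a ⊔ b) c := by
    refine Submodule.disjoint_def.mpr fun t hta htc => ?_
    obtain ⟨s, rfl⟩ := hc' t htc
    obtain ⟨t, ht, u, hu, h⟩ := Submodule.mem_sup.mp hta
    obtain ⟨r, rfl⟩ := hb' u hu
    -- The coordinate of `x²` vanishes on the first two summands and equals `s` on the third.
    have h := congrArg (fun t => elimEval θ χ δ x t ([], 2)) h
    simp [hvan _ ht 1, elimEval_ι_self, elimEval_ι_self_sq] at h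
    simp [← h]
  have hι : FreeAlgebra.ι ℂ x ≠ 0 := FreeAlgebra.ι_ne_zero x
  have hι2 : FreeAlgebra.ι ℂ x * FreeAlgebra.ι ℂ x ≠ 0 := by
    intro h
    have h := congrArg (elimEval θ χ δ x) h
    rw [elimEval_ι_self_sq, map_zero] at h
    simp at h
  have e1 := Submodule.finrank_sup_add_finrank_inf_eq a b
  have e2 := Submodule.finrank_sup_add_finrank_inf_eq (a ⊔ b) c
  rw [h1.eq_bot, finrank_bot, add_zero] at e1
  rw [h2.eq_bot, finrank_bot, add_zero, ← hsup] at e2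
  rw [e2, e1]
  rw [hb, hc, finrank_ite_span_singleton _ hι, finrank_ite_span_singleton _ hι2,
    (Submodule.equivMapOfInjective (elimHom θ χ δ x).toLinearMap
      (elimHom_injective θ χ δ x) (liePoly θ χ (elimDeg δ x) m)).finrank_eq, ha, elimLie]

end Elimination

end FreeColoredLie

namespace FreeColoredLie

/-! ### Counting words and comparing dimensions -/

variable {A D : Type*} [AddCommGroup A] [AddCommMonoid D]

/-- The word in the original letters which encodes a word in the letters after elimination. -/
def expand {X : Type*} (x : X) : List (ElimLetter x) → List X
  | [] => []
  | p :: u => p.1 :: (List.replicate p.2 x ++ expand x u)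

/-- The letter `(y, k)` is encoded as `y` followed by `k` copies of `x`, so an encoded word never
begins with `x`. This makes decoding unique and leaves some words outside the image. -/
theorem expand_ne_cons {X : Type*} (x : X) (u : List (ElimLetter x)) (l : List X) :
    expand x u ≠ x :: l := by
  cases u with
  | nil => simp [expand]
  | cons p u => simp [expand, p.1.2]

theorem replicate_append_inj {X : Type*} {x : X} {s t : List X} (hs : ∀ l, s ≠ x :: l)
    (ht : ∀ l, t ≠ x :: l) : ∀ {j k : ℕ}, List.replicate j x ++ s = List.replicate k x ++ t →
      j = k ∧ s = t
  | 0, 0, h => ⟨rfl, by simpa using h⟩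
  | 0, k + 1, h => absurd (by simpa [List.replicate_succ] using h) (hs _)
  | j + 1, 0, h => absurd (by simpa [List.replicate_succ] using h.symm) (ht _)
  | j + 1, k + 1, h => by
    have h1 := replicate_append_inj hs ht (j := j) (k := k)
      (by simpa [List.replicate_succ] using h)
    exact ⟨by rw [h1.1], h1.2⟩

theorem expand_injective {X : Type*} (x : X) : Function.Injective (expand x) := by
  intro u
  induction u with
  | nil => intro v h; cases v with
    | nil => rfl
    | cons q v => simp [expand] at h
  | cons p u ih => intro v h; cases v with
    | nil => simp [expand] at h
    | cons q v =>
      simp only [expand, List.cons.injEq] at h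
      have h2 := replicate_append_inj (expand_ne_cons x u) (expand_ne_cons x v) h.2
      rw [ih h2.2, Prod.ext (Subtype.ext h.1) h2.1]

theorem sum_expand {X : Type*} (δ : X → D) (x : X) (u : List (ElimLetter x)) :
    ((expand x u).map δ).sum = (u.map (elimDeg δ x)).sum := by
  induction u with
  | nil => simp [expand]
  | cons p u ih =>
    simp only [expand, List.map_cons, List.map_append, List.map_replicate, List.sum_cons,
      List.sum_append, List.sum_replicate, ih, elimDeg]
    rw [← add_assoc, add_comm (δ _)]

/-- The nonempty words of degree `m`. -/
def wordsOfDeg {X : Type*} (δ : X → D) (m : D) : Set (List X) :=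
  {l | l ≠ [] ∧ (l.map δ).sum = m}

theorem expand_mem_wordsOfDeg {X : Type*} (δ : X → D) (x : X) {m : D} {u : List (ElimLetter x)}
    (hu : u ∈ wordsOfDeg (elimDeg δ x) m) : expand x u ∈ wordsOfDeg δ m := by
  refine ⟨?_, by rw [sum_expand]; exact hu.2⟩
  obtain ⟨h, _⟩ := hu
  cases u with
  | nil => exact absurd rfl h
  | cons p u => simp [expand]

theorem wordsOfDeg_elimDeg_finite {X : Type*} (δ : X → D) (x : X) {m : D}
    (hm : (wordsOfDeg δ m).Finite) : (wordsOfDeg (elimDeg δ x) m).Finite :=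
  Set.Finite.of_finite_image (hm.subset (Set.image_subset_iff.mpr fun _ hu =>
    expand_mem_wordsOfDeg δ x hu)) (expand_injective x).injOn

-- The encoding is injective and misses every word that begins with `x`. Moving an occurrence of `x`
-- in `l` to the front gives such a word of the same degree, so the count drops strictly.
open Classical in
theorem ncard_wordsOfDeg_elimDeg_lt {X : Type*} (δ : X → D) {x : X} {m : D}
    (hm : (wordsOfDeg δ m).Finite) {l : List X} (hl : l ∈ wordsOfDeg δ m) (hx : x ∈ l) :
    (wordsOfDeg (elimDeg δ x) m).ncard < (wordsOfDeg δ m).ncard := by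
  rw [← Set.ncard_image_of_injective _ (expand_injective x)]
  refine Set.ncard_lt_ncard ⟨Set.image_subset_iff.mpr fun _ hu =>
    expand_mem_wordsOfDeg δ x hu, fun h => ?_⟩ hm
  have hp : l.Perm (x :: l.erase x) := List.perm_cons_erase hx
  have h1 : x :: l.erase x ∈ wordsOfDeg δ m :=
    ⟨by simp, by rw [← hl.2]; exact ((hp.map δ).sum_eq).symm⟩
  obtain ⟨u, _, hu⟩ := h h1
  exact expand_ne_cons x u _ hu

/-- Doubling a word is injective and doubles its degree, so finiteness passes to halves. -/
theorem wordsOfDeg_finite_of_add_self {X : Type*} (δ : X → D) {e m : D} (he : e + e = m)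
    (hm : (wordsOfDeg δ m).Finite) : (wordsOfDeg δ e).Finite := by
  refine Set.Finite.of_finite_image (f := fun l => l ++ l) (hm.subset ?_) ?_
  · rintro _ ⟨l, ⟨hl, rfl⟩, rfl⟩
    exact ⟨by simp [hl], by simpa using he⟩
  · intro l _ k _ h
    have h1 := congrArg List.length h
    simp only [List.length_append] at h1
    exact (List.append_inj h (by omega)).1

theorem finrank_liePoly_of_isEmpty {X : Type*} (θ : ColoringMap A) (χ : D →+ A) (δ : X → D) {m : D}
    (h : wordsOfDeg δ m = ∅) : Module.finrank ℂ (liePoly θ χ δ m) = 0 := by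
  have h1 : wordSpan δ m = ⊥ := by
    have h' : {l : List X | l ≠ [] ∧ (l.map δ).sum = m} = ∅ := h
    rw [wordSpan, h', Set.image_empty, Submodule.span_empty]
  rw [eq_bot_iff.mpr ((liePoly_le_wordSpan θ χ δ m).trans h1.le), finrank_bot]

/-- The trivial coloring map. -/
def trivialColoring (A : Type*) [AddCommGroup A] : ColoringMap A where
  toFun _ _ := 1
  map_add_left _ _ _ := (mul_one 1).symm
  map_add_right _ _ _ := (mul_one 1).symm
  mul_swap _ _ := mul_one 1

theorem trivialColoring_val (a b : A) : (trivialColoring A).val a b = 1 := by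
  simp [trivialColoring, ColoringMap.val]

theorem not_isOdd_trivialColoring (a : A) : ¬(trivialColoring A).IsOdd a := by
  rw [ColoringMap.IsOdd, ColoringMap.sign, trivialColoring_val]
  norm_num

/-- The comparison of dimensions of Lie polynomials and colored Lie polynomials. -/
theorem finrank_liePoly_eq_add_sum (θ : ColoringMap A) (χ : D →+ A) {m : D} (S : Finset D)
    (hS : ∀ e ∈ S, e + e = m ∧ θ.IsOdd (χ e)) (n : ℕ) :
    ∀ {X : Type*} (δ : X → D), (wordsOfDeg δ m).Finite → (wordsOfDeg δ m).ncard = n →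
      (∀ e, e + e = m → θ.IsOdd (χ e) → (wordsOfDeg δ e).Nonempty → e ∈ S) →
      Module.finrank ℂ (liePoly θ χ δ m) = Module.finrank ℂ (liePoly (trivialColoring A) χ δ m) +
        ∑ e ∈ S, Module.finrank ℂ (liePoly (trivialColoring A) χ δ e) := by
  classical
  -- The induction is on the number of words of degree `m`. The alphabet varies and may become
  -- infinite, but the degree, the coloring and `S` stay fixed.
  induction n using Nat.strong_induction_on with
  | _ n ih =>
  intro X δ hm hn hS'
  rcases (wordsOfDeg δ m).eq_empty_or_nonempty with h0 | ⟨l, hl⟩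
  · rw [finrank_liePoly_of_isEmpty _ _ _ h0, finrank_liePoly_of_isEmpty _ _ _ h0, zero_add]
    refine (Finset.sum_eq_zero fun e he => finrank_liePoly_of_isEmpty _ _ _ ?_).symm
    refine Set.eq_empty_of_forall_notMem fun l hl => ?_
    -- A word in half the degree would double to a word of degree `m`, and there is none.
    have h1 : l ++ l ∈ wordsOfDeg δ m :=
      ⟨by simp [hl.1], by simpa [hl.2] using (hS e he).1⟩
    rw [h0] at h1
    exact h1
  · obtain ⟨x, hx⟩ := List.exists_mem_of_ne_nil l hl.1
    have hlt := ncard_wordsOfDeg_elimDeg_lt δ hm hl hx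
    have key := ih _ (hn ▸ hlt) (elimDeg δ x) (wordsOfDeg_elimDeg_finite δ x hm) rfl
      (fun e he ho ⟨u, hu⟩ => hS' e he ho ⟨_, expand_mem_wordsOfDeg δ x hu⟩)
    rw [finrank_liePoly θ χ δ x hm, finrank_liePoly (trivialColoring A) χ δ x hm, key,
      Finset.sum_congr rfl fun e he => finrank_liePoly (trivialColoring A) χ δ x
        (wordsOfDeg_finite_of_add_self δ (hS e he).1 hm)]
    simp only [not_isOdd_trivialColoring, and_false, if_false, add_zero, Finset.sum_add_distrib]
    -- The line of `x` in the trivially colored algebra, counted over the halves `e`, matches the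
    -- line of `x²` in the colored one.
    have hsum : (∑ e ∈ S, if δ x = e then 1 else 0) =
        if δ x + δ x = m ∧ θ.IsOdd (χ (δ x)) then 1 else 0 := by
      rw [Finset.sum_ite_eq]
      refine if_congr ⟨fun h => hS _ h, fun h => hS' _ h.1 h.2 ⟨[x], by simp, by simp⟩⟩ rfl rfl
    rw [hsum]
    ring

end FreeColoredLie

namespace FreeColoredLie

/-! ### The colored commutator as a bracket on the free associative algebra -/

variable {A D X : Type*} [AddCommGroup A] [AddCommMonoid D]

/-- The span of all words of degree `m`. -/
noncomputable def fullSpan (δ : X → D) (m : D) : Submodule ℂ (FreeAlgebra ℂ X) :=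
  Submodule.span ℂ (word '' {l | (l.map δ).sum = m})

theorem wordSpan_le_fullSpan (δ : X → D) (m : D) : wordSpan δ m ≤ fullSpan δ m :=
  Submodule.span_mono (Set.image_mono fun _ h => h.2)

theorem comm_mem_fullSpan (θ : ColoringMap A) (χ : D →+ A) {δ : X → D} {d e : D}
    {u v : FreeAlgebra ℂ X} (hu : u ∈ fullSpan δ d) (hv : v ∈ fullSpan δ e) :
    comm θ χ d e u v ∈ fullSpan δ (d + e) := by
  have hmul : ∀ {d e : D} {u v : FreeAlgebra ℂ X}, u ∈ fullSpan δ d → v ∈ fullSpan δ e →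
      u * v ∈ fullSpan δ (d + e) := by
    intro d e u v hu hv
    have h := Submodule.mul_mem_mul hu hv
    rw [fullSpan, fullSpan, Submodule.span_mul_span] at h
    refine Submodule.span_mono ?_ h
    rintro _ ⟨_, ⟨l, rfl, rfl⟩, _, ⟨k, rfl, rfl⟩, rfl⟩
    exact ⟨l ++ k, by simp, word_append l k⟩
  refine sub_mem (hmul hu hv) (Submodule.smul_mem _ _ ?_)
  rw [add_comm]
  exact hmul hv hu

/-- The colored commutator on the free associative algebra whose letters have the colors `c`. -/
noncomputable def wordBracket (θ : ColoringMap A) (c : X → A) :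
    FreeAlgebra ℂ X →ₗ[ℂ] FreeAlgebra ℂ X →ₗ[ℂ] FreeAlgebra ℂ X :=
  LinearMap.mul ℂ _ - (wordBasis X).constr ℂ fun l => (wordBasis X).constr ℂ fun k =>
    θ.val (l.map c).sum (k.map c).sum • word (k ++ l)

theorem wordBracket_word (θ : ColoringMap A) (c : X → A) (l k : List X) :
    wordBracket θ c (word l) (word k) =
      word l * word k - θ.val (l.map c).sum (k.map c).sum • (word k * word l) := by
  rw [wordBracket, LinearMap.sub_apply, LinearMap.sub_apply, LinearMap.mul_apply', ← word_append k l,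
    ← wordBasis_apply l, Module.Basis.constr_basis, ← wordBasis_apply k, Module.Basis.constr_basis]

section

variable (θ : ColoringMap A) (χ : D →+ A) (δ : X → D) {c : X → A} (hc : ∀ x, χ (δ x) = c x)

include hc in
theorem map_sum_degree (l : List X) : (l.map c).sum = χ (l.map δ).sum := by
  rw [map_list_sum, List.map_map]
  congr 2
  exact funext fun x => (hc x).symm

include hc in
theorem wordBracket_eq_comm_of_fullSpan {d e : D} {u v : FreeAlgebra ℂ X} (hu : u ∈ fullSpan δ d)
    (hv : v ∈ fullSpan δ e) : wordBracket θ c u v = comm θ χ d e u v := by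
  have h := bilin_mem_of_span (p := ⊥) (wordBracket θ c - commₗ θ χ d e (FreeAlgebra ℂ X))
    (s := word '' {l | (l.map δ).sum = d}) (t := word '' {l | (l.map δ).sum = e}) ?_ hu hv
  · rw [Submodule.mem_bot] at h
    exact sub_eq_zero.mp h
  · rintro _ ⟨l, rfl, rfl⟩ _ ⟨k, rfl, rfl⟩
    rw [LinearMap.sub_apply, LinearMap.sub_apply, wordBracket_word, commₗ_apply, comm,
      map_sum_degree χ δ hc, map_sum_degree χ δ hc, sub_self]
    exact zero_mem _

include hc in
theorem wordBracket_eq_comm {d e : D} {u v : FreeAlgebra ℂ X} (hu : u ∈ wordSpan δ d)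
    (hv : v ∈ wordSpan δ e) : wordBracket θ c u v = comm θ χ d e u v :=
  wordBracket_eq_comm_of_fullSpan θ χ δ hc (wordSpan_le_fullSpan δ d hu)
    (wordSpan_le_fullSpan δ e hv)

end

variable {Γ : Type*} [AddCommSemigroup Γ]

/-- The color of a degree, where a zero has been adjoined to the degrees. -/
noncomputable def colorHom (Γ A : Type*) [AddCommSemigroup Γ] [AddCommGroup A] :
    WithZero (Γ × A) →+ A :=
  WithZero.lift (AddHom.snd Γ A)

@[simp] theorem colorHom_coe (d : Γ × A) : colorHom Γ A d = d.2 :=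
  WithZero.lift_coe _ _

/-- The degree of a letter in `WithZero (Γ × A)`. -/
def coeDeg (δ : X → Γ × A) (x : X) : WithZero (Γ × A) := δ x

/-- The third argument of the Jacobi identity is arbitrary, so that identity is checked on all basis
words, including the empty one. This is why `fullSpan` is used and why a zero is adjoined to the
degrees. -/
theorem isColoredLieBracket_wordBracket (θ : ColoringMap A) (δ : X → Γ × A) :
    IsColoredLieBracket θ (fun d : Γ × A => wordSpan (coeDeg δ) (d : WithZero (Γ × A)))
      (wordBracket θ fun x => (δ x).2) := by
  have hc : ∀ x, colorHom Γ A (coeDeg δ x) = (δ x).2 := fun x => colorHom_coe (δ x)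
  refine ⟨fun d e u v hu hv => ?_, fun d e u v hu hv => ?_, fun d e u v w hu hv => ?_⟩
  · rw [wordBracket_eq_comm θ _ _ hc hu hv, WithZero.coe_add]
    exact comm_mem_wordSpan θ _ _ hu hv
  · rw [wordBracket_eq_comm θ _ _ hc hu hv, wordBracket_eq_comm θ _ _ hc hv hu, comm_skew]
    simp
  · have hu := wordSpan_le_fullSpan _ _ hu
    have hv := wordSpan_le_fullSpan _ _ hv
    have key : ∀ l : List X,
        wordBracket θ (fun x => (δ x).2) u (wordBracket θ (fun x => (δ x).2) v (word l)) =
          wordBracket θ (fun x => (δ x).2) (wordBracket θ (fun x => (δ x).2) u v) (word l) +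
            θ.val d.2 e.2 • wordBracket θ (fun x => (δ x).2) v
              (wordBracket θ (fun x => (δ x).2) u (word l)) := by
      intro l
      have hl : word l ∈ fullSpan (coeDeg δ) (l.map (coeDeg δ)).sum :=
        Submodule.subset_span ⟨l, rfl, rfl⟩
      rw [wordBracket_eq_comm_of_fullSpan θ _ _ hc hv hl,
        wordBracket_eq_comm_of_fullSpan θ _ _ hc hu hl,
        wordBracket_eq_comm_of_fullSpan θ _ _ hc hu hv,
        wordBracket_eq_comm_of_fullSpan θ _ _ hc hu (comm_mem_fullSpan θ _ hv hl),
        wordBracket_eq_comm_of_fullSpan θ _ _ hc hv (comm_mem_fullSpan θ _ hu hl),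
        wordBracket_eq_comm_of_fullSpan θ _ _ hc (comm_mem_fullSpan θ _ hu hv) hl, comm_jacobi]
      simp
    set B := wordBracket θ (fun x => (δ x).2)
    have h : B u ∘ₗ B v = B (B u v) + θ.val d.2 e.2 • (B v ∘ₗ B u) :=
      (wordBasis X).ext fun l => by simpa [wordBasis_apply] using key l
    exact LinearMap.congr_fun h w

/-! ### The Dynkin operator -/

section Dynkin

variable {V : Type*} [AddCommGroup V] [Module ℂ V] (θ : ColoringMap A) (𝒱 : Γ × A → Submodule ℂ V)
  (b : Module.Basis X ℂ V) (δ : X → Γ × A)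

open FreeLieSuperalgebra

/-- The linear map from `V` to the free associative algebra on a basis of `V`. -/
noncomputable def toFree : V →ₗ[ℂ] FreeAlgebra ℂ X := b.constr ℂ (FreeAlgebra.ι ℂ)

@[simp] theorem toFree_basis (x : X) : toFree b (b x) = FreeAlgebra.ι ℂ x := by
  simp [toFree]

/-- The basis `b` consists of bases of the homogeneous subspaces. -/
def IsHomogeneousBasis : Prop := ∀ d, 𝒱 d = Submodule.span ℂ (b '' {x | δ x = d})

variable {𝒱 b δ} (hb : IsHomogeneousBasis 𝒱 b δ)

omit [AddCommGroup A] [AddCommSemigroup Γ] in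
include hb in
theorem IsHomogeneousBasis.mem (x : X) : b x ∈ 𝒱 (δ x) := by
  rw [hb]
  exact Submodule.subset_span ⟨x, rfl, rfl⟩

include hb in
theorem toFree_mem (d : Γ × A) (v : V) (hv : v ∈ 𝒱 d) :
    toFree b v ∈ wordSpan (coeDeg δ) (d : WithZero (Γ × A)) := by
  rw [hb] at hv
  suffices h : Submodule.span ℂ (b '' {x | δ x = d}) ≤
      (wordSpan (coeDeg δ) (d : WithZero (Γ × A))).comap (toFree b) from h hv
  refine Submodule.span_le.mpr ?_
  rintro _ ⟨x, rfl, rfl⟩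
  change toFree b (b x) ∈ wordSpan (coeDeg δ) (coeDeg δ x)
  rw [toFree_basis]
  exact ι_mem_wordSpan _ x

/-- The homomorphism from the free colored Lie superalgebra to the free associative algebra. -/
noncomputable def toWords : FreeLieSuperalgebra θ 𝒱 →ₗ[ℂ] FreeAlgebra ℂ X :=
  lift (isColoredLieBracket_wordBracket θ δ) (toFree b) (toFree_mem hb)

theorem toWords_ι (v : V) : toWords θ hb (ι θ 𝒱 v) = toFree b v :=
  lift_ι _ _ (toFree_mem hb) v

theorem toWords_bracket (x y : FreeLieSuperalgebra θ 𝒱) :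
    toWords θ hb (bracket θ 𝒱 x y) =
      wordBracket θ (fun x => (δ x).2) (toWords θ hb x) (toWords θ hb y) :=
  lift_bracket _ _ (toFree_mem hb) x y

theorem toWords_mem {d : Γ × A} {x : FreeLieSuperalgebra θ 𝒱} (hx : x ∈ piece θ 𝒱 d) :
    toWords θ hb x ∈ wordSpan (coeDeg δ) (d : WithZero (Γ × A)) :=
  lift_mem (isColoredLieBracket_wordBracket θ δ) _ (toFree_mem hb) d x hx

theorem toWords_bracket_of_mem {d e : Γ × A} {x y : FreeLieSuperalgebra θ 𝒱}
    (hx : x ∈ piece θ 𝒱 d) (hy : y ∈ piece θ 𝒱 e) : toWords θ hb (bracket θ 𝒱 x y) =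
      comm θ (colorHom Γ A) d e (toWords θ hb x) (toWords θ hb y) := by
  rw [toWords_bracket]
  exact wordBracket_eq_comm θ _ (coeDeg δ) (fun x => colorHom_coe (δ x))
    (toWords_mem θ hb hx) (toWords_mem θ hb hy)

variable (𝒱 b)

/-- The right-normed bracket of a word. -/
noncomputable def nestedBracket : List X → FreeLieSuperalgebra θ 𝒱
  | [] => 0
  | [x] => ι θ 𝒱 (b x)
  | x :: y :: l => bracket θ 𝒱 (ι θ 𝒱 (b x)) (nestedBracket (y :: l))

theorem nestedBracket_cons (x : X) {l : List X} (hl : l ≠ []) :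
    nestedBracket θ 𝒱 b (x :: l) = bracket θ 𝒱 (ι θ 𝒱 (b x)) (nestedBracket θ 𝒱 b l) := by
  cases l with
  | nil => exact absurd rfl hl
  | cons y l => rfl

/-- The linear extension of the right-normed bracketing. -/
noncomputable def dynkin : FreeAlgebra ℂ X →ₗ[ℂ] FreeLieSuperalgebra θ 𝒱 :=
  (wordBasis X).constr ℂ (nestedBracket θ 𝒱 b)

theorem dynkin_word (l : List X) : dynkin θ 𝒱 b (word l) = nestedBracket θ 𝒱 b l := by
  rw [dynkin, ← wordBasis_apply, Module.Basis.constr_basis]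

/-- The adjoint action of the free associative algebra. -/
noncomputable def adHom : FreeAlgebra ℂ X →ₐ[ℂ] Module.End ℂ (FreeLieSuperalgebra θ 𝒱) :=
  FreeAlgebra.lift ℂ fun x => bracket θ 𝒱 (ι θ 𝒱 (b x))

theorem adHom_ι (x : X) : adHom θ 𝒱 b (FreeAlgebra.ι ℂ x) = bracket θ 𝒱 (ι θ 𝒱 (b x)) := by
  rw [adHom, FreeAlgebra.lift_ι_apply]

theorem nestedBracket_append (l : List X) {k : List X} (hk : k ≠ []) :
    nestedBracket θ 𝒱 b (l ++ k) = adHom θ 𝒱 b (word l) (nestedBracket θ 𝒱 b k) := by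
  induction l with
  | nil => simp
  | cons x l ih =>
    rw [List.cons_append, nestedBracket_cons θ 𝒱 b x (by simp [hk]), ih, word_cons, map_mul,
      adHom_ι, Module.End.mul_apply]

/-- Right-normed bracketing applies the letters of `t` successively as adjoint operators. The factor
`s` must have no constant term, because the bracketing of the empty word is set to `0`. -/
theorem dynkin_mul {δ' : X → D} {m : D} (t : FreeAlgebra ℂ X) {s : FreeAlgebra ℂ X}
    (hs : s ∈ wordSpan δ' m) : dynkin θ 𝒱 b (t * s) = adHom θ 𝒱 b t (dynkin θ 𝒱 b s) := by
  have h1 : ∀ k : List X, k ≠ [] → ∀ t, dynkin θ 𝒱 b (t * word k) =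
      adHom θ 𝒱 b t (dynkin θ 𝒱 b (word k)) := by
    intro k hk t
    suffices h : dynkin θ 𝒱 b ∘ₗ LinearMap.mulRight ℂ (word k) =
        LinearMap.applyₗ (dynkin θ 𝒱 b (word k)) ∘ₗ (adHom θ 𝒱 b).toLinearMap from
      LinearMap.congr_fun h t
    refine (wordBasis X).ext fun l => ?_
    simp only [LinearMap.comp_apply, wordBasis_apply, LinearMap.mulRight_apply, ← word_append,
      dynkin_word, nestedBracket_append θ 𝒱 b l hk]
    rfl
  suffices h : wordSpan δ' m ≤ LinearMap.eqLocus (dynkin θ 𝒱 b ∘ₗ LinearMap.mulLeft ℂ t)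
      (adHom θ 𝒱 b t ∘ₗ dynkin θ 𝒱 b) from h hs
  refine Submodule.span_le.mpr ?_
  rintro _ ⟨k, hk, rfl⟩
  exact h1 k hk.1 t

theorem adHom_toFree (v : V) : adHom θ 𝒱 b (toFree b v) = bracket θ 𝒱 (ι θ 𝒱 v) := by
  suffices h : (adHom θ 𝒱 b).toLinearMap ∘ₗ toFree b = bracket θ 𝒱 ∘ₗ ι θ 𝒱 from
    LinearMap.congr_fun h v
  refine b.ext fun x => ?_
  simp [adHom_ι]

theorem dynkin_toFree (v : V) : dynkin θ 𝒱 b (toFree b v) = ι θ 𝒱 v := by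
  suffices h : dynkin θ 𝒱 b ∘ₗ toFree b = ι θ 𝒱 from LinearMap.congr_fun h v
  refine b.ext fun x => ?_
  have h := dynkin_word θ 𝒱 b [x]
  rw [word_cons, word_nil, mul_one] at h
  simpa [nestedBracket] using h

theorem toFree_mem_length (v : V) : toFree b v ∈ wordSpan (fun _ : X => 1) 1 := by
  suffices h : (⊤ : Submodule ℂ V) ≤ (wordSpan (fun _ : X => 1) 1).comap (toFree b) from
    h Submodule.mem_top
  rw [← b.span_eq]
  refine Submodule.span_le.mpr ?_
  rintro _ ⟨x, rfl⟩
  change toFree b (b x) ∈ wordSpan (fun _ : X => 1) 1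
  rw [toFree_basis]
  exact ι_mem_wordSpan _ x

variable {𝒱 b}

theorem mkQ_mem_piece {d : Γ × A} {m : Pre V} (h : IsMonomial 𝒱 d m) :
    (relIdeal θ 𝒱).mkQ m ∈ piece θ 𝒱 d :=
  ⟨m, Submodule.subset_span h, rfl⟩

/-- The Dynkin–Specht–Wever theorem for monomials. -/
theorem dynkin_toWords_monomial {d : Γ × A} {m : Pre V} (h : IsMonomial 𝒱 d m) :
    ∃ n : ℕ, n ≠ 0 ∧ toWords θ hb ((relIdeal θ 𝒱).mkQ m) ∈ wordSpan (fun _ : X => 1) n ∧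
      adHom θ 𝒱 b (toWords θ hb ((relIdeal θ 𝒱).mkQ m)) = bracket θ 𝒱 ((relIdeal θ 𝒱).mkQ m) ∧
      dynkin θ 𝒱 b (toWords θ hb ((relIdeal θ 𝒱).mkQ m)) = (n : ℂ) • (relIdeal θ 𝒱).mkQ m := by
  -- The induction needs all three clauses: the length, for `dynkin_mul`; the adjoint action of the
  -- word image; and the eigenvalue itself.
  induction h with
  | of d v hv =>
    have h1 : toWords θ hb ((relIdeal θ 𝒱).mkQ (gen v)) = toFree b v := toWords_ι θ hb v
    refine ⟨1, one_ne_zero, ?_, ?_, ?_⟩ <;> rw [h1]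
    · exact toFree_mem_length b v
    · exact adHom_toFree θ 𝒱 b v
    · rw [dynkin_toFree, Nat.cast_one, one_smul]
      rfl
  | mul d e x y hx hy ihx ihy =>
    obtain ⟨n, hn, hn1, hn2, hn3⟩ := ihx
    obtain ⟨k, hk, hk1, hk2, hk3⟩ := ihy
    have hx' := mkQ_mem_piece θ hx
    have hy' := mkQ_mem_piece θ hy
    rw [← bracket_mk]
    set x' := (relIdeal θ 𝒱).mkQ x
    set y' := (relIdeal θ 𝒱).mkQ y
    have hco := toWords_bracket_of_mem θ hb hx' hy'
    refine ⟨n + k, by omega, ?_, ?_, ?_⟩ <;> rw [hco]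
    · rw [comm]
      refine sub_mem (mul_mem_wordSpan hn1 hk1) (Submodule.smul_mem _ _ ?_)
      rw [add_comm]
      exact mul_mem_wordSpan hk1 hn1
    · refine LinearMap.ext fun z => ?_
      have hj := (isColoredLieBracket θ 𝒱).jacobi d e x' y' z hx' hy'
      rw [comm, map_sub, map_smul, map_mul, map_mul, hn2, hk2]
      simp only [colorHom_coe, LinearMap.sub_apply, LinearMap.smul_apply, Module.End.mul_apply]
      rw [hj, add_sub_cancel_right]
    -- The two terms are `k [x, y]` and `-θ(d, e) n [y, x]`; skew-symmetry turns the second into `n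
    -- [x, y]`.
    · have hs := (isColoredLieBracket θ 𝒱).skew e d y' x' hy' hx'
      rw [comm, map_sub, map_smul, dynkin_mul θ 𝒱 b _ hk1, dynkin_mul θ 𝒱 b _ hn1, hn2, hk2, hn3,
        hk3, map_smul, map_smul, hs]
      simp only [colorHom_coe]
      rw [smul_neg, smul_neg, sub_neg_eq_add, smul_comm (n : ℂ), smul_smul, θ.val_mul_swap,
        one_smul, Nat.cast_add, add_smul, add_comm]

variable (𝒱 b)

/-- The Dynkin operator, divided by the length of the word. -/
noncomputable def normDynkin : FreeAlgebra ℂ X →ₗ[ℂ] FreeLieSuperalgebra θ 𝒱 :=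
  (wordBasis X).constr ℂ fun l => (l.length : ℂ)⁻¹ • nestedBracket θ 𝒱 b l

theorem normDynkin_word (l : List X) :
    normDynkin θ 𝒱 b (word l) = (l.length : ℂ)⁻¹ • nestedBracket θ 𝒱 b l := by
  rw [normDynkin, ← wordBasis_apply, Module.Basis.constr_basis]

theorem normDynkin_eq {n : ℕ} {u : FreeAlgebra ℂ X} (hu : u ∈ wordSpan (fun _ : X => 1) n) :
    normDynkin θ 𝒱 b u = (n : ℂ)⁻¹ • dynkin θ 𝒱 b u := by
  suffices h : wordSpan (fun _ : X => 1) n ≤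
      LinearMap.eqLocus (normDynkin θ 𝒱 b) ((n : ℂ)⁻¹ • dynkin θ 𝒱 b) from h hu
  refine Submodule.span_le.mpr ?_
  rintro _ ⟨l, ⟨_, hl⟩, rfl⟩
  have hl : l.length = n := by simpa using hl
  change normDynkin θ 𝒱 b (word l) = (n : ℂ)⁻¹ • dynkin θ 𝒱 b (word l)
  rw [normDynkin_word, dynkin_word, hl]

variable {𝒱 b}

theorem normDynkin_toWords_monomial {d : Γ × A} {m : Pre V} (h : IsMonomial 𝒱 d m) :
    normDynkin θ 𝒱 b (toWords θ hb ((relIdeal θ 𝒱).mkQ m)) = (relIdeal θ 𝒱).mkQ m := by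
  obtain ⟨n, hn, h1, -, h3⟩ := dynkin_toWords_monomial θ hb h
  rw [normDynkin_eq θ 𝒱 b h1, h3, smul_smul, inv_mul_cancel₀ (Nat.cast_ne_zero.mpr hn), one_smul]

/-- Two linear maps agree on a homogeneous subspace if they agree on the monomials. -/
theorem eq_on_piece {M : Type*} [AddCommGroup M] [Module ℂ M]
    {E F : FreeLieSuperalgebra θ 𝒱 →ₗ[ℂ] M} {d : Γ × A}
    (h : ∀ m, IsMonomial 𝒱 d m → E ((relIdeal θ 𝒱).mkQ m) = F ((relIdeal θ 𝒱).mkQ m))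
    {x : FreeLieSuperalgebra θ 𝒱} (hx : x ∈ piece θ 𝒱 d) : E x = F x := by
  suffices hle : piece θ 𝒱 d ≤ LinearMap.eqLocus E F from hle hx
  rw [piece, Submodule.map_le_iff_le_comap]
  exact Submodule.span_le.mpr h

theorem normDynkin_toWords {d : Γ × A} {x : FreeLieSuperalgebra θ 𝒱} (hx : x ∈ piece θ 𝒱 d) :
    normDynkin θ 𝒱 b (toWords θ hb x) = x :=
  eq_on_piece θ (E := normDynkin θ 𝒱 b ∘ₗ toWords θ hb) (F := LinearMap.id)
    (fun _ hm => normDynkin_toWords_monomial θ hb hm) hx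

include hb in
theorem nestedBracket_mem (l : List X) (hl : l ≠ []) : ∃ d : Γ × A,
    (l.map (coeDeg δ)).sum = d ∧ nestedBracket θ 𝒱 b l ∈ piece θ 𝒱 d := by
  induction l with
  | nil => exact absurd rfl hl
  | cons x l ih =>
    rcases eq_or_ne l [] with rfl | hl
    · exact ⟨δ x, by simp [coeDeg], ι_mem θ 𝒱 _ _ (hb.mem x)⟩
    · obtain ⟨d, h1, h2⟩ := ih hl
      refine ⟨δ x + d, by simp [h1, coeDeg], ?_⟩
      rw [nestedBracket_cons θ 𝒱 b x hl]
      exact (isColoredLieBracket θ 𝒱).graded _ _ _ _ (ι_mem θ 𝒱 _ _ (hb.mem x)) h2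

include hb in
theorem normDynkin_mem {d : Γ × A} {u : FreeAlgebra ℂ X}
    (hu : u ∈ wordSpan (coeDeg δ) (d : WithZero (Γ × A))) : normDynkin θ 𝒱 b u ∈ piece θ 𝒱 d := by
  suffices h : wordSpan (coeDeg δ) (d : WithZero (Γ × A)) ≤
      (piece θ 𝒱 d).comap (normDynkin θ 𝒱 b) from h hu
  refine Submodule.span_le.mpr ?_
  rintro _ ⟨l, ⟨hl, hd⟩, rfl⟩
  obtain ⟨e, he, h⟩ := nestedBracket_mem θ hb l hl
  obtain rfl : e = d := WithZero.coe_injective (he.symm.trans hd)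
  change normDynkin θ 𝒱 b (word l) ∈ piece θ 𝒱 e
  rw [normDynkin_word]
  exact Submodule.smul_mem _ _ h

/-! #### The projection onto the Lie polynomials -/

/-- The projection of the free associative algebra onto the Lie polynomials. -/
noncomputable def lieProj : FreeAlgebra ℂ X →ₗ[ℂ] FreeAlgebra ℂ X :=
  toWords θ hb ∘ₗ normDynkin θ 𝒱 b

section Refined

variable (χ : D →+ A) (δ' : X → D) (hχ : ∀ x, χ (δ' x) = (δ x).2)

include hχ

/-- The degrees `δ'` may be any that determine the colors of the letters. This freedom lets the
projection respect gradings by eigenvalue and by rank as well. -/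
theorem toWords_nestedBracket (l : List X) (hl : l ≠ []) :
    LieMon θ χ δ' (l.map δ').sum (toWords θ hb (nestedBracket θ 𝒱 b l)) := by
  induction l with
  | nil => exact absurd rfl hl
  | cons x l ih =>
    rcases eq_or_ne l [] with rfl | hl
    · rw [nestedBracket, toWords_ι, toFree_basis]
      simpa using LieMon.of x
    · have h := ih hl
      rw [nestedBracket_cons θ 𝒱 b x hl, toWords_bracket, toWords_ι, toFree_basis,
        wordBracket_eq_comm θ χ δ' hχ (ι_mem_wordSpan δ' x) h.mem_wordSpan, List.map_cons,
        List.sum_cons]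
      exact LieMon.comm _ _ _ _ (LieMon.of x) h

theorem lieProj_word_mem (l : List X) (hl : l ≠ []) :
    lieProj θ hb (word l) ∈ liePoly θ χ δ' (l.map δ').sum := by
  rw [lieProj, LinearMap.comp_apply, normDynkin_word, map_smul]
  exact Submodule.smul_mem _ _ (Submodule.subset_span (toWords_nestedBracket θ hb χ δ' hχ l hl))

theorem lieProj_mem {m : D} {u : FreeAlgebra ℂ X} (hu : u ∈ wordSpan δ' m) :
    lieProj θ hb u ∈ liePoly θ χ δ' m := by
  suffices h : wordSpan δ' m ≤ (liePoly θ χ δ' m).comap (lieProj θ hb) from h hu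
  refine Submodule.span_le.mpr ?_
  rintro _ ⟨l, ⟨hl, rfl⟩, rfl⟩
  exact lieProj_word_mem θ hb χ δ' hχ l hl

/-- Commutators depend only on colors, so a Lie monomial for `δ'` is also one for `δ`, and it lifts
to a bracketed word on which Dynkin–Specht–Wever applies. -/
theorem exists_monomial_of_lieMon {m : D} {u : FreeAlgebra ℂ X} (hu : LieMon θ χ δ' m u) :
    ∃ d y, IsMonomial 𝒱 d y ∧ toWords θ hb ((relIdeal θ 𝒱).mkQ y) = u := by
  induction hu with
  | of x =>
    exact ⟨δ x, gen (b x), IsMonomial.of _ _ (hb.mem x),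
      (toWords_ι θ hb (b x)).trans (toFree_basis b x)⟩
  | comm d e u v hu hv ihu ihv =>
    obtain ⟨d', y, hy, rfl⟩ := ihu
    obtain ⟨e', z, hz, rfl⟩ := ihv
    refine ⟨d' + e', y * z, IsMonomial.mul _ _ _ _ hy hz, ?_⟩
    rw [← bracket_mk, toWords_bracket, wordBracket_eq_comm θ χ δ' hχ hu.mem_wordSpan hv.mem_wordSpan]

theorem lieProj_eq_self {m : D} {u : FreeAlgebra ℂ X} (hu : u ∈ liePoly θ χ δ' m) :
    lieProj θ hb u = u := by
  suffices h : liePoly θ χ δ' m ≤ LinearMap.eqLocus (lieProj θ hb) LinearMap.id from h hu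
  refine Submodule.span_le.mpr fun u hu => ?_
  obtain ⟨d, y, hy, rfl⟩ := exists_monomial_of_lieMon θ hb χ δ' hχ hu
  exact congrArg (toWords θ hb) (normDynkin_toWords_monomial θ hb hy)

end Refined

end Dynkin

end FreeColoredLie

namespace FreeColoredLie

/-! ### Traces of restrictions and of projections -/

/-- The trace of the restriction of an endomorphism to the span of a finite part of a basis. -/
theorem trace_restrict_span {κ M : Type*} [AddCommGroup M] [Module ℂ M] (b : Module.Basis κ ℂ M)
    (s : Finset κ) {N : Submodule ℂ M} (hN : N = Submodule.span ℂ (b '' s)) (f : M →ₗ[ℂ] M)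
    (hf : ∀ x ∈ N, f x ∈ N) :
    LinearMap.trace ℂ N (f.restrict hf) = ∑ i ∈ s, b.repr (f (b i)) i := by
  classical
  subst hN
  have hli : LinearIndependent ℂ fun i : s => b i := b.linearIndependent.comp _ Subtype.val_injective
  have hr : Set.range (fun i : s => b i) = b '' s := by
    ext; simp
  let bs : Module.Basis s ℂ (Submodule.span ℂ (b '' s)) :=
    (Module.Basis.span hli).map (LinearEquiv.ofEq _ _ (by rw [hr]))
  have hbs : ∀ i, (bs i : M) = b i := fun i => by
    simp [bs, Module.Basis.span_apply]
  have hrepr : ∀ (v : Submodule.span ℂ (b '' s)) (i : s), bs.repr v i = b.repr v i := by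
    intro v i
    suffices h : (Finsupp.lapply i) ∘ₗ bs.repr.toLinearMap =
        (Finsupp.lapply (i : κ)) ∘ₗ b.repr.toLinearMap ∘ₗ (Submodule.span ℂ (b '' s)).subtype from
      LinearMap.congr_fun h v
    refine bs.ext fun j => ?_
    change bs.repr (bs j) i = b.repr (bs j : M) i
    rw [hbs, Module.Basis.repr_self, Module.Basis.repr_self, Finsupp.single_apply,
      Finsupp.single_apply]
    exact if_congr Subtype.ext_iff rfl rfl
  rw [LinearMap.trace_eq_matrix_trace ℂ bs, Matrix.trace, ← Finset.sum_coe_sort s]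
  refine Finset.sum_congr rfl fun i _ => ?_
  rw [Matrix.diag_apply, LinearMap.toMatrix_apply, hrepr, LinearMap.coe_restrict_apply, hbs]

/-- The trace of a projection. -/
theorem trace_restrict_eq_finrank {M : Type*} [AddCommGroup M] [Module ℂ M] {L N : Submodule ℂ M}
    [FiniteDimensional ℂ N] (hLN : L ≤ N) (f : M →ₗ[ℂ] M) (hN : ∀ u ∈ N, f u ∈ N)
    (hL : ∀ u ∈ N, f u ∈ L) (hf : ∀ u ∈ L, f u = u) :
    LinearMap.trace ℂ N (f.restrict hN) = (Module.finrank ℂ L : ℂ) := by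
  have h : LinearMap.IsProj (L.submoduleOf N) (f.restrict hN) :=
    ⟨fun u => hL u u.2, fun u hu => Subtype.ext (hf u hu)⟩
  rw [h.trace, (Submodule.submoduleOfEquivOfLe hLN).finrank_eq]

variable {A D X : Type*} [AddCommGroup A] [AddCommMonoid D]

theorem wordSpan_eq_span (δ : X → D) {m : D} (hm : (wordsOfDeg δ m).Finite) :
    wordSpan δ m = Submodule.span ℂ (wordBasis X '' (hm.toFinset : Set (List X))) := by
  rw [hm.coe_toFinset, wordSpan]
  congr 1
  exact Set.image_congr fun l _ => (wordBasis_apply l).symm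

variable {Γ V : Type*} [AddCommSemigroup Γ] [AddCommGroup V] [Module ℂ V] (θ : ColoringMap A)
  {𝒱 : Γ × A → Submodule ℂ V} {b : Module.Basis X ℂ V} {δ : X → Γ × A}
  (hb : IsHomogeneousBasis 𝒱 b δ)

/-- The diagonal coefficient of the projection onto the Lie polynomials. -/
noncomputable def diagCoeff (l : List X) : ℂ := (wordBasis X).repr (lieProj θ hb (word l)) l

/-- On each refined degree `lieProj` is a projection onto the Lie polynomials, so its trace,
computed on words, is their dimension. The coefficients themselves do not depend on the chosen
refinement. -/
theorem sum_diagCoeff (χ : D →+ A) (δ' : X → D) (hχ : ∀ x, χ (δ' x) = (δ x).2) {m : D}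
    (hm : (wordsOfDeg δ' m).Finite) :
    ∑ l ∈ hm.toFinset, diagCoeff θ hb l = (Module.finrank ℂ (liePoly θ χ δ' m) : ℂ) := by
  have hmem : ∀ u ∈ wordSpan δ' m, lieProj θ hb u ∈ wordSpan δ' m := fun u hu =>
    liePoly_le_wordSpan θ χ δ' m (lieProj_mem θ hb χ δ' hχ hu)
  have hfin : FiniteDimensional ℂ (wordSpan δ' m) := finiteDimensional_wordSpan δ' hm
  have h1 := trace_restrict_span (wordBasis X) hm.toFinset (wordSpan_eq_span δ' hm)
    (lieProj θ hb) hmem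
  rw [trace_restrict_eq_finrank (liePoly_le_wordSpan θ χ δ' m) (lieProj θ hb) hmem
    (fun u hu => lieProj_mem θ hb χ δ' hχ hu) (fun u hu => lieProj_eq_self θ hb χ δ' hχ hu)] at h1
  rw [h1]
  exact Finset.sum_congr rfl fun l _ => by rw [wordBasis_apply, diagCoeff]

/-! ### Traces of triangular endomorphisms -/

section Triangular

variable (b)

/-- The endomorphism of the free associative algebra induced by an endomorphism of `V`. -/
noncomputable def mapWords (f : V →ₗ[ℂ] V) : FreeAlgebra ℂ X →ₐ[ℂ] FreeAlgebra ℂ X :=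
  FreeAlgebra.lift ℂ fun x => toFree b (f (b x))

theorem mapWords_toFree (f : V →ₗ[ℂ] V) (v : V) :
    mapWords b f (toFree b v) = toFree b (f v) := by
  suffices h : (mapWords b f).toLinearMap ∘ₗ toFree b = toFree b ∘ₗ f from LinearMap.congr_fun h v
  refine b.ext fun x => ?_
  simp [mapWords]

theorem repr_toFree_mul (v : V) (t : FreeAlgebra ℂ X) (z : X) (l : List X) :
    (wordBasis X).repr (toFree b v * t) (z :: l) = b.repr v z * (wordBasis X).repr t l := by
  classical
  suffices h : ((LinearMap.mul ℂ (FreeAlgebra ℂ X)).compr₂ (Finsupp.lapply (z :: l) ∘ₗ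
      (wordBasis X).repr.toLinearMap)) ∘ₗ toFree b = (LinearMap.mul ℂ ℂ).compl₁₂
        (Finsupp.lapply z ∘ₗ b.repr.toLinearMap)
        (Finsupp.lapply l ∘ₗ (wordBasis X).repr.toLinearMap) from
    LinearMap.congr_fun (LinearMap.congr_fun h v) t
  refine b.ext fun x => (wordBasis X).ext fun k => ?_
  have h : FreeAlgebra.ι ℂ x * wordBasis X k = wordBasis X (x :: k) := by
    simp [wordBasis_apply]
  simp only [LinearMap.comp_apply, toFree_basis, LinearMap.compr₂_apply, LinearMap.mul_apply', h,
    LinearMap.compl₁₂_apply, LinearEquiv.coe_coe, Module.Basis.repr_self, Finsupp.lapply_apply,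
    Finsupp.single_apply, List.cons.injEq]
  split_ifs <;> simp_all

theorem repr_toFree_mul_nil (v : V) (t : FreeAlgebra ℂ X) :
    (wordBasis X).repr (toFree b v * t) [] = 0 := by
  suffices h : ((LinearMap.mul ℂ (FreeAlgebra ℂ X)).compr₂ (Finsupp.lapply [] ∘ₗ
      (wordBasis X).repr.toLinearMap)) ∘ₗ toFree b = 0 from
    LinearMap.congr_fun (LinearMap.congr_fun h v) t
  refine b.ext fun x => (wordBasis X).ext fun k => ?_
  have h : FreeAlgebra.ι ℂ x * wordBasis X k = wordBasis X (x :: k) := by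
    simp [wordBasis_apply]
  simp [h]

/-- The endomorphism `f` is triangular with respect to the ranking `rk` of the basis `b`, with
diagonal entries `ev`. -/
structure IsTriangular (f : V →ₗ[ℂ] V) (rk : X → ℕ) (ev : X → ℂ) : Prop where
  diag : ∀ x, b.repr (f (b x)) x = ev x
  lt : ∀ x z, b.repr (f (b x)) z ≠ 0 → z = x ∨ rk x < rk z

theorem IsTriangular.comp_self {f : V →ₗ[ℂ] V} {rk : X → ℕ} {ev : X → ℂ}
    (h : IsTriangular b f rk ev) : IsTriangular b (f ∘ₗ f) rk fun x => ev x ^ 2 := by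
  have key : ∀ x z, b.repr (f (f (b x))) z =
      (b.repr (f (b x))).sum fun y c => c * b.repr (f (b y)) z := by
    intro x z
    conv_lhs => rw [← b.linearCombination_repr (f (b x))]
    simp [Finsupp.linearCombination_apply, Finsupp.sum, map_sum]
  refine ⟨fun x => ?_, fun x z hz => ?_⟩
  · rw [LinearMap.comp_apply, key, Finsupp.sum, Finset.sum_eq_single x]
    · rw [h.diag, sq]
    · intro y hy hyx
      by_contra hne
      have h1 := h.lt x y (Finsupp.mem_support_iff.mp hy)
      have h2 := h.lt y x (right_ne_zero_of_mul hne)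
      grind
    · intro hx
      rw [Finsupp.notMem_support_iff.mp hx, zero_mul]
  · rw [LinearMap.comp_apply, key, Finsupp.sum] at hz
    obtain ⟨y, hy, hne⟩ := Finset.exists_ne_zero_of_sum_ne_zero hz
    have h1 := h.lt x y (Finsupp.mem_support_iff.mp hy)
    have h2 := h.lt y z (right_ne_zero_of_mul hne)
    grind

variable {b} {f : V →ₗ[ℂ] V} {rk : X → ℕ} {ev : X → ℂ} (hf : IsTriangular b f rk ev)
include hf

theorem repr_mapWords_self (l : List X) :
    (wordBasis X).repr (mapWords b f (word l)) l = (l.map ev).prod := by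
  induction l with
  | nil =>
    rw [word_nil, map_one, ← word_nil, ← wordBasis_apply]
    simp
  | cons x l ih =>
    rw [word_cons, map_mul, ← toFree_basis b x, mapWords_toFree, repr_toFree_mul, ih, hf.diag]
    simp

theorem repr_mapWords_ne_zero (l : List X) : ∀ k, (wordBasis X).repr (mapWords b f (word l)) k ≠ 0 →
    k = l ∨ (l.map rk).sum < (k.map rk).sum := by
  induction l with
  | nil =>
    classical
    intro k h
    rw [word_nil, map_one, ← word_nil, ← wordBasis_apply, Module.Basis.repr_self,
      Finsupp.single_apply] at h
    exact Or.inl (by simpa [eq_comm] using h)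
  | cons x l ih =>
    intro k h
    rw [word_cons, map_mul, ← toFree_basis b x, mapWords_toFree] at h
    cases k with
    | nil => exact absurd (repr_toFree_mul_nil b _ _) h
    | cons z k =>
      rw [repr_toFree_mul] at h
      have h1 := hf.lt x z (left_ne_zero_of_mul h)
      have h2 := ih k (right_ne_zero_of_mul h)
      simp only [List.map_cons, List.sum_cons]
      rcases h1 with rfl | h1 <;> rcases h2 with rfl | h2
      · exact Or.inl rfl
      all_goals right; omega

/-- The induced map fixes a word up to its diagonal entry and otherwise strictly raises the total
rank. Within one rank it therefore acts on coefficients as a diagonal map. -/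
theorem repr_mapWords_of_rank {n : ℕ} {l : List X} (hl : (l.map rk).sum = n) {u : FreeAlgebra ℂ X}
    (hu : u ∈ wordSpan rk n) :
    (wordBasis X).repr (mapWords b f u) l = (l.map ev).prod * (wordBasis X).repr u l := by
  classical
  suffices h : wordSpan rk n ≤ LinearMap.eqLocus
      (Finsupp.lapply l ∘ₗ (wordBasis X).repr.toLinearMap ∘ₗ (mapWords b f).toLinearMap)
      ((l.map ev).prod • (Finsupp.lapply l ∘ₗ (wordBasis X).repr.toLinearMap)) from h hu
  refine Submodule.span_le.mpr ?_
  rintro _ ⟨k, ⟨_, hk⟩, rfl⟩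
  change (wordBasis X).repr (mapWords b f (word k)) l =
    (l.map ev).prod * (wordBasis X).repr (word k) l
  rw [← wordBasis_apply k, Module.Basis.repr_self, wordBasis_apply]
  by_cases hkl : k = l
  · subst hkl
    rw [repr_mapWords_self hf, Finsupp.single_eq_same, mul_one]
  · rw [Finsupp.single_eq_of_ne (Ne.symm hkl), mul_zero]
    by_contra hne
    rcases repr_mapWords_ne_zero hf k l hne with h | h
    · exact hkl h.symm
    · omega

end Triangular

/-! ### The trace on the homogeneous subspaces of the free colored Lie superalgebra -/

section Trace

open FreeLieSuperalgebra

variable {G : Type*} [Group G] (ρ : Representation ℂ G V)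
  (hρ : ∀ g d, ∀ v ∈ 𝒱 d, ρ g v ∈ 𝒱 d)

theorem toWords_rep (g : G) {d : Γ × A} {x : FreeLieSuperalgebra θ 𝒱} (hx : x ∈ piece θ 𝒱 d) :
    toWords θ hb (rep θ 𝒱 ρ hρ g x) = mapWords b (ρ g) (toWords θ hb x) := by
  refine eq_on_piece θ (E := toWords θ hb ∘ₗ rep θ 𝒱 ρ hρ g)
    (F := (mapWords b (ρ g)).toLinearMap ∘ₗ toWords θ hb) (fun m hm => ?_) hx
  change toWords θ hb (rep θ 𝒱 ρ hρ g ((relIdeal θ 𝒱).mkQ m)) =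
    mapWords b (ρ g) (toWords θ hb ((relIdeal θ 𝒱).mkQ m))
  clear hx
  induction hm with
  | of d v hv =>
    change toWords θ hb (rep θ 𝒱 ρ hρ g (ι θ 𝒱 v)) = mapWords b (ρ g) (toWords θ hb (ι θ 𝒱 v))
    rw [rep_ι, toWords_ι, toWords_ι, mapWords_toFree]
  | mul d e x y hx hy ihx ihy =>
    have hx' := mkQ_mem_piece θ hx
    have hy' := mkQ_mem_piece θ hy
    rw [← bracket_mk, rep_bracket, toWords_bracket_of_mem θ hb hx' hy',
      toWords_bracket_of_mem θ hb (rep_mem θ 𝒱 ρ hρ g d _ hx') (rep_mem θ 𝒱 ρ hρ g e _ hy'),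
      ihx, ihy, comm_map]

/-- The words of degree `d` are finite in number. -/
abbrev FinitelyManyWords (δ : X → Γ × A) : Prop :=
  ∀ d : Γ × A, (wordsOfDeg (coeDeg δ) (d : WithZero (Γ × A))).Finite

include hb in
theorem finiteDimensional_piece (hW : FinitelyManyWords δ) (d : Γ × A) :
    FiniteDimensional ℂ (piece θ 𝒱 d) := by
  have := finiteDimensional_wordSpan (coeDeg δ) (hW d)
  refine FiniteDimensional.of_injective
    ((toWords θ hb).restrict (fun x hx => toWords_mem θ hb (d := d) hx)) fun x y h => ?_
  have h1 := congrArg (fun t => normDynkin θ 𝒱 b t.1) h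
  simp only [LinearMap.coe_restrict_apply, normDynkin_toWords θ hb x.2,
    normDynkin_toWords θ hb y.2] at h1
  exact Subtype.ext h1

/-- The action factors through the space of words, and cyclicity of the trace moves the computation
there. The operator becomes `mapWords` after `lieProj`; the latter preserves total rank, so only the
diagonal entries of `g` survive. -/
theorem trace_rep (hW : FinitelyManyWords δ) (g : G) {rk : X → ℕ} {ev : X → ℂ}
    (hg : IsTriangular b (ρ g) rk ev) (d : Γ × A) :
    LinearMap.trace ℂ (piece θ 𝒱 d) ((rep θ 𝒱 ρ hρ g).restrict (rep_mem θ 𝒱 ρ hρ g d)) =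
      ∑ l ∈ (hW d).toFinset, (l.map ev).prod * diagCoeff θ hb l := by
  have hfin := finiteDimensional_piece θ hb hW d
  have hfinW : FiniteDimensional ℂ (wordSpan (coeDeg δ) (d : WithZero (Γ × A))) :=
    finiteDimensional_wordSpan (coeDeg δ) (hW d)
  let i : piece θ 𝒱 d →ₗ[ℂ] wordSpan (coeDeg δ) (d : WithZero (Γ × A)) :=
    (toWords θ hb ∘ₗ rep θ 𝒱 ρ hρ g).restrict
      (fun x hx => toWords_mem θ hb (rep_mem θ 𝒱 ρ hρ g d x hx))
  let r : wordSpan (coeDeg δ) (d : WithZero (Γ × A)) →ₗ[ℂ] piece θ 𝒱 d :=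
    (normDynkin θ 𝒱 b).restrict (fun u hu => normDynkin_mem θ hb hu)
  have h1 : (rep θ 𝒱 ρ hρ g).restrict (rep_mem θ 𝒱 ρ hρ g d) = r ∘ₗ i := by
    refine LinearMap.ext fun x => Subtype.ext ?_
    exact (normDynkin_toWords θ hb (rep_mem θ 𝒱 ρ hρ g d x x.2)).symm
  have h2 : ∀ u ∈ wordSpan (coeDeg δ) (d : WithZero (Γ × A)),
      ((toWords θ hb ∘ₗ rep θ 𝒱 ρ hρ g) ∘ₗ normDynkin θ 𝒱 b) u ∈
        wordSpan (coeDeg δ) (d : WithZero (Γ × A)) := fun u hu => (i (r ⟨u, hu⟩)).2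
  have h3 : i ∘ₗ r = ((toWords θ hb ∘ₗ rep θ 𝒱 ρ hρ g) ∘ₗ normDynkin θ 𝒱 b).restrict h2 := rfl
  rw [h1, LinearMap.trace_comp_comm', h3, trace_restrict_span (wordBasis X) (hW d).toFinset
    (wordSpan_eq_span _ (hW d))]
  refine Finset.sum_congr rfl fun l hl => ?_
  rw [Set.Finite.mem_toFinset] at hl
  have hmem : word l ∈ wordSpan (coeDeg δ) (d : WithZero (Γ × A)) :=
    Submodule.subset_span ⟨l, hl, rfl⟩
  -- The letters are graded by color and rank together, since a grading must determine the color to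
  -- be respected by `lieProj`; the color is then forgotten.
  have hrank : lieProj θ hb (word l) ∈ wordSpan rk (l.map rk).sum := by
    have h := lieProj_word_mem θ hb (D := A × ℕ) (AddMonoidHom.fst A ℕ) (fun x => ((δ x).2, rk x))
      (fun _ => rfl) l hl.1
    have h := liePoly_le_wordSpan _ _ _ _ h
    have hsub : wordsOfDeg (fun x => ((δ x).2, rk x)) (l.map fun x => ((δ x).2, rk x)).sum ⊆
        wordsOfDeg rk (l.map rk).sum := by
      rintro k ⟨hk, h2⟩
      refine ⟨hk, ?_⟩
      have h2 := congrArg (AddMonoidHom.snd A ℕ) h2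
      rw [map_list_sum, map_list_sum, List.map_map, List.map_map] at h2
      exact h2
    exact Submodule.span_mono (Set.image_mono hsub) h
  rw [wordBasis_apply, diagCoeff, LinearMap.comp_apply, LinearMap.comp_apply,
    toWords_rep θ hb ρ hρ g (normDynkin_mem θ hb hmem)]
  exact repr_mapWords_of_rank hg rfl hrank

/-- The degree of a letter, refined by its eigenvalue. -/
def evDeg (δ : X → Γ × A) (ev : X → ℂ) (x : X) : WithZero (Γ × A) × Additive ℂ :=
  (coeDeg δ x, Additive.ofMul (ev x))

/-- The color of a refined degree. -/
noncomputable def evColor (Γ A : Type*) [AddCommSemigroup Γ] [AddCommGroup A] :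
    WithZero (Γ × A) × Additive ℂ →+ A :=
  (colorHom Γ A).comp (AddMonoidHom.fst _ _)

theorem mem_wordsOfDeg_evDeg (ev : X → ℂ) (d : WithZero (Γ × A)) (c : ℂ) (l : List X) :
    l ∈ wordsOfDeg (evDeg δ ev) (d, Additive.ofMul c) ↔
      l ∈ wordsOfDeg (coeDeg δ) d ∧ (l.map ev).prod = c := by
  have h : (l.map (evDeg δ ev)).sum =
      ((l.map (coeDeg δ)).sum, Additive.ofMul (l.map ev).prod) := by
    induction l with
    | nil => rfl
    | cons x l ih => simp [ih, evDeg, ofMul_mul]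
  simp only [wordsOfDeg, Set.mem_ofPred_eq, h, Prod.mk.injEq, EmbeddingLike.apply_eq_iff_eq, and_assoc]

theorem wordsOfDeg_evDeg_finite (hW : FinitelyManyWords δ) (ev : X → ℂ) (d : Γ × A) (c : ℂ) :
    (wordsOfDeg (evDeg δ ev) (d, Additive.ofMul c)).Finite :=
  (hW d).subset fun l hl => ((mem_wordsOfDeg_evDeg ev (d : WithZero (Γ × A)) c l).mp hl).1

/-- The dimension of the space of Lie polynomials of degree `d` and eigenvalue `c`. -/
noncomputable def evDim (θ : ColoringMap A) (δ : X → Γ × A) (ev : X → ℂ) (d : Γ × A) (c : ℂ) : ℂ :=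
  (Module.finrank ℂ (liePoly θ (evColor Γ A) (evDeg δ ev) (d, Additive.ofMul c)) : ℂ)

/-- Words are grouped by eigenvalue. A general weight `φ` serves both `g`, with `φ c = c`, and `g²`,
with `φ c = c²`. -/
theorem sum_diagCoeff_mul (hW : FinitelyManyWords δ) (ev : X → ℂ) (φ : ℂ → ℂ) (d : Γ × A)
    (Λ : Finset ℂ) (hΛ : ∀ l ∈ wordsOfDeg (coeDeg δ) (d : WithZero (Γ × A)), (l.map ev).prod ∈ Λ) :
    ∑ l ∈ (hW d).toFinset, φ (l.map ev).prod * diagCoeff θ hb l =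
      ∑ c ∈ Λ, φ c * evDim θ δ ev d c := by
  classical
  rw [← Finset.sum_fiberwise_of_maps_to (g := fun l : List X => (l.map ev).prod)
    (fun l hl => hΛ l ((hW d).mem_toFinset.mp hl))]
  refine Finset.sum_congr rfl fun c _ => ?_
  have h := sum_diagCoeff θ hb (evColor Γ A) (evDeg δ ev)
    (fun x => colorHom_coe (δ x)) (wordsOfDeg_evDeg_finite hW ev d c)
  rw [evDim, ← h, Finset.mul_sum]
  refine Finset.sum_congr ?_ fun l hl => ?_
  · ext l
    simp [mem_wordsOfDeg_evDeg]
  · rw [Set.Finite.mem_toFinset, mem_wordsOfDeg_evDeg] at hl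
    rw [hl.2]

end Trace

end FreeColoredLie

namespace FreeColoredLie

/-! ### Triangular bases and finiteness of words -/

/-- Every endomorphism of a finite-dimensional complex vector space is triangular with respect to
some basis. -/
theorem exists_triangular_basis (n : ℕ) : ∀ {M : Type*} [AddCommGroup M] [Module ℂ M]
    [FiniteDimensional ℂ M] (f : M →ₗ[ℂ] M), Module.finrank ℂ M = n →
      ∃ (b : Module.Basis (Fin n) ℂ M), ∀ i j, b.repr (f (b i)) j ≠ 0 → j = i ∨ i < j := by
  induction n with
  | zero =>
    intro M _ _ _ f hn
    exact ⟨Module.finBasisOfFinrankEq ℂ M hn, fun i => i.elim0⟩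
  | succ n ih =>
    intro M _ _ _ f hn
    have hnt : Nontrivial M := Module.nontrivial_of_finrank_pos (R := ℂ) (by omega)
    -- The kernel of an eigenvector of the dual map is an invariant hyperplane. A vector outside it
    -- is placed first, where the triangularity condition imposes nothing.
    obtain ⟨c, hc⟩ := Module.End.exists_eigenvalue (K := ℂ) (V := Module.Dual ℂ M) f.dualMap
    obtain ⟨φ, hφ, hφ0⟩ := hc.exists_hasEigenvector
    have hφ1 : ∀ x, φ (f x) = c * φ x := fun x =>
      LinearMap.congr_fun (Module.End.mem_eigenspace_iff.mp hφ) x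
    have hker : ∀ x ∈ LinearMap.ker φ, f x ∈ LinearMap.ker φ := fun x hx => by
      rw [LinearMap.mem_ker] at hx ⊢
      rw [hφ1, hx, mul_zero]
    have hdim : Module.finrank ℂ (LinearMap.ker φ) = n := by
      have h := Module.Dual.finrank_ker_add_one_of_ne_zero hφ0
      omega
    obtain ⟨b, hb⟩ := ih (f.restrict hker) hdim
    obtain ⟨y, hy⟩ : ∃ y, φ y = 1 := LinearMap.surjective hφ0 1
    let B : Module.Basis (Fin (n + 1)) ℂ M := Module.Basis.mkFinCons y b
      (fun r x hx h => by
        have h1 := congrArg φ h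
        simpa [LinearMap.mem_ker.mp hx, hy] using h1)
      (fun z => ⟨-φ z, by simp [hy]⟩)
    have hB0 : B 0 = y := by simp [B]
    have hBs : ∀ i : Fin n, B i.succ = b i := fun i => by simp [B]
    have hr0 : ∀ w : LinearMap.ker φ, B.repr w 0 = 0 := by
      intro w
      suffices h : Finsupp.lapply 0 ∘ₗ B.repr.toLinearMap ∘ₗ (LinearMap.ker φ).subtype = 0 from
        LinearMap.congr_fun h w
      refine b.ext fun i => ?_
      change B.repr (b i) 0 = 0
      rw [← hBs, Module.Basis.repr_self, Finsupp.single_eq_of_ne (Fin.succ_ne_zero i).symm]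
    have hrs : ∀ (w : LinearMap.ker φ) (j : Fin n), B.repr w j.succ = b.repr w j := by
      intro w j
      suffices h : Finsupp.lapply j.succ ∘ₗ B.repr.toLinearMap ∘ₗ (LinearMap.ker φ).subtype =
          Finsupp.lapply j ∘ₗ b.repr.toLinearMap from LinearMap.congr_fun h w
      refine b.ext fun i => ?_
      change B.repr (b i) j.succ = b.repr (b i) j
      rw [← hBs, Module.Basis.repr_self, Module.Basis.repr_self, Finsupp.single_apply,
        Finsupp.single_apply]
      exact if_congr (Fin.succ_inj) rfl rfl
    refine ⟨B, fun i j h => ?_⟩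
    induction i using Fin.cases with
    | zero =>
      rcases eq_or_ne j 0 with rfl | hj
      · exact Or.inl rfl
      · exact Or.inr (Fin.pos_of_ne_zero hj)
    | succ i =>
      rw [hBs] at h
      induction j using Fin.cases with
      | zero => exact absurd (hr0 (f.restrict hker (b i))) h
      | succ j =>
        have h1 := hrs (f.restrict hker (b i)) j
        rw [LinearMap.coe_restrict_apply] at h1
        rw [h1] at h
        rcases hb i j h with rfl | hlt
        · exact Or.inl rfl
        · exact Or.inr (Fin.succ_lt_succ_iff.mpr hlt)

variable {Γ A : Type*} [AddCommSemigroup Γ] [AddCommGroup A]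

theorem finite_setOf_map_eq {X Y : Type*} (δ : X → Y) (hδ : ∀ y, {x | δ x = y}.Finite) :
    ∀ L : List Y, {l : List X | l.map δ = L}.Finite
  | [] => (Set.finite_singleton []).subset fun l hl => by simpa using hl
  | y :: L => by
    refine ((hδ y).image2 List.cons (finite_setOf_map_eq δ hδ L)).subset ?_
    intro l hl
    cases l with
    | nil => exact absurd hl (by simp)
    | cons x l =>
      have hl : δ x :: l.map δ = y :: L := hl
      rw [List.cons.injEq] at hl
      exact ⟨x, hl.1, l, hl.2, rfl⟩

theorem exists_freeAddSemigroup {S : Type*} [AddCommSemigroup S] (L : List S) (hL : L ≠ []) :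
    ∃ w : FreeAddSemigroup S, w.head :: w.tail = L ∧
      ((FreeAddSemigroup.lift (id : S → S) w : S) : WithZero S) =
        (L.map ((↑) : S → WithZero S)).sum := by
  induction L with
  | nil => exact absurd rfl hL
  | cons x L ih =>
    rcases eq_or_ne L [] with rfl | hL
    · exact ⟨FreeAddSemigroup.of x, rfl, by simp⟩
    · obtain ⟨w, h1, h2⟩ := ih hL
      refine ⟨FreeAddSemigroup.of x + w, ?_, ?_⟩
      · rw [← h1]
        simp
      · rw [map_add, WithZero.coe_add, h2]
        simp

/-- The sequence of degrees of a word is a decomposition of its total degree, and each such sequence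
comes from finitely many words. -/
theorem finitelyManyWords {X : Type*} (δ : X → Γ × A) (hδ : ∀ d, {x | δ x = d}.Finite)
    (hfin : FiniteDecompositions (Γ × A)) : FinitelyManyWords δ := by
  intro d
  have h := ((hfin d).image fun w => w.head :: w.tail).biUnion fun L _ =>
    finite_setOf_map_eq δ hδ L
  refine h.subset ?_
  rintro l ⟨hl, hs⟩
  obtain ⟨w, h1, h2⟩ := exists_freeAddSemigroup (l.map δ) (by simpa using hl)
  refine Set.mem_biUnion (x := l.map δ) ⟨w, ?_, h1⟩ rfl
  rw [List.map_map] at h2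
  exact WithZero.coe_injective (h2.trans hs)

omit [AddCommSemigroup Γ] [AddCommGroup A] in
theorem exists_homogeneous_triangular_basis {V : Type*} [DecidableEq (Γ × A)] [AddCommGroup V]
    [Module ℂ V] (𝒱 : Γ × A → Submodule ℂ V) (h𝒱 : DirectSum.IsInternal 𝒱)
    (hdim : ∀ d, FiniteDimensional ℂ (𝒱 d)) (f : V →ₗ[ℂ] V) (hf : ∀ d, ∀ v ∈ 𝒱 d, f v ∈ 𝒱 d) :
    ∃ (b : Module.Basis (Σ d, Fin (Module.finrank ℂ (𝒱 d))) ℂ V)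
      (rk : (Σ d, Fin (Module.finrank ℂ (𝒱 d))) → ℕ)
      (ev : (Σ d, Fin (Module.finrank ℂ (𝒱 d))) → ℂ),
      IsHomogeneousBasis 𝒱 b Sigma.fst ∧ IsTriangular b f rk ev := by
  choose b hb using fun d => exists_triangular_basis (Module.finrank ℂ (𝒱 d)) (f.restrict (hf d)) rfl
  let B := h𝒱.collectedBasis b
  have hB : ∀ x, B x = b x.1 x.2 := fun x => by simp [B]
  -- Ranks may repeat across degrees: `f` preserves degrees, so coefficients between different
  -- degrees vanish.
  refine ⟨B, fun x => x.2, fun x => B.repr (f (B x)) x, fun d => ?_, fun x => rfl, ?_⟩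
  · have h1 : B '' {x | x.1 = d} = (𝒱 d).subtype '' Set.range (b d) := by
      ext v
      constructor
      · rintro ⟨⟨e, i⟩, rfl, rfl⟩
        exact ⟨b e i, ⟨i, rfl⟩, (hB ⟨e, i⟩).symm⟩
      · rintro ⟨_, ⟨i, rfl⟩, rfl⟩
        exact ⟨⟨d, i⟩, rfl, hB _⟩
    rw [h1, Submodule.span_image, (b d).span_eq, Submodule.map_subtype_top]
  · rintro ⟨d, i⟩ ⟨e, j⟩ h
    have hmem : f (B ⟨d, i⟩) ∈ 𝒱 d := by
      rw [hB]
      exact hf d _ (b d i).2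
    by_cases hde : d = e
    · subst hde
      rw [h𝒱.collectedBasis_repr_of_mem b hmem] at h
      have h2 : (⟨f (B ⟨d, i⟩), hmem⟩ : 𝒱 d) = f.restrict (hf d) (b d i) := by
        apply Subtype.ext
        rw [LinearMap.coe_restrict_apply]
        exact congrArg f (hB ⟨d, i⟩)
      rw [h2] at h
      rcases hb d i j h with rfl | hlt
      · exact Or.inl rfl
      · exact Or.inr hlt
    · exact absurd (h𝒱.collectedBasis_repr_of_mem_ne b hde hmem) h

/-! ### Comparison with the free Lie algebra -/

section FreeLie

open FreeLieSuperalgebra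

variable {V X : Type*} [AddCommGroup V] [Module ℂ V] (𝒱 : Γ × A → Submodule ℂ V)

/-- The bracket of the free Lie algebra as a bilinear map. -/
noncomputable def lieBracketₗ (V : Type*) [AddCommGroup V] [Module ℂ V] :
    FreeLie V →ₗ[ℂ] FreeLie V →ₗ[ℂ] FreeLie V :=
  (LieModule.toEnd ℂ (FreeLie V) (FreeLie V) : FreeLie V →ₗ[ℂ] Module.End ℂ (FreeLie V))

theorem lieBracketₗ_apply (x y : FreeLie V) : lieBracketₗ V x y = ⁅x, y⁆ := rfl

theorem isColoredLieBracket_freeLie :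
    IsColoredLieBracket (trivialColoring A) (FreeLie.piece 𝒱) (lieBracketₗ V) := by
  refine ⟨fun d e x y hx hy => ?_, fun d e x y _ _ => ?_, fun d e x y z _ _ => ?_⟩
  · exact bilin_mem_of_span (lieBracketₗ V)
      (fun x hx y hy => Submodule.subset_span (FreeLie.IsMonomial.lie d e x y hx hy)) hx hy
  · rw [trivialColoring_val, one_smul, lieBracketₗ_apply, lieBracketₗ_apply, lie_skew]
  · simp only [trivialColoring_val, one_smul, lieBracketₗ_apply]
    exact leibniz_lie x y z

/-- The homomorphism from the free colored Lie superalgebra with trivial coloring to the free Lie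
algebra. -/
noncomputable def toFreeLie : FreeLieSuperalgebra (trivialColoring A) 𝒱 →ₗ[ℂ] FreeLie V :=
  FreeLieSuperalgebra.lift (isColoredLieBracket_freeLie 𝒱) (FreeLie.ι V)
    (fun d v hv => Submodule.subset_span (FreeLie.IsMonomial.of d v hv))

theorem toFreeLie_ι (v : V) :
    toFreeLie 𝒱 (FreeLieSuperalgebra.ι (trivialColoring A) 𝒱 v) = FreeLie.ι V v :=
  FreeLieSuperalgebra.lift_ι _ _ _ v

theorem toFreeLie_bracket (x y : FreeLieSuperalgebra (trivialColoring A) 𝒱) :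
    toFreeLie 𝒱 (bracket _ 𝒱 x y) = lieBracketₗ V (toFreeLie 𝒱 x) (toFreeLie 𝒱 y) :=
  FreeLieSuperalgebra.lift_bracket _ _ _ x y

theorem toFreeLie_mem {d : Γ × A} {x : FreeLieSuperalgebra (trivialColoring A) 𝒱}
    (hx : x ∈ FreeLieSuperalgebra.piece _ 𝒱 d) : toFreeLie 𝒱 x ∈ FreeLie.piece 𝒱 d :=
  FreeLieSuperalgebra.lift_mem _ _ _ d x hx

theorem exists_toFreeLie_eq {d : Γ × A} {y : FreeLie V} (hy : y ∈ FreeLie.piece 𝒱 d) :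
    ∃ x ∈ FreeLieSuperalgebra.piece (trivialColoring A) 𝒱 d, toFreeLie 𝒱 x = y := by
  suffices h : FreeLie.piece 𝒱 d ≤
      (FreeLieSuperalgebra.piece (trivialColoring A) 𝒱 d).map (toFreeLie 𝒱) from h hy
  clear hy
  refine Submodule.span_le.mpr fun y hm => ?_
  change FreeLie.IsMonomial 𝒱 d y at hm
  induction hm with
  | of d v hv => exact ⟨_, FreeLieSuperalgebra.ι_mem _ 𝒱 d v hv, toFreeLie_ι 𝒱 v⟩
  | lie d e _ _ _ _ ih1 ih2 =>
    obtain ⟨x, hx, rfl⟩ := ih1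
    obtain ⟨y, hy, rfl⟩ := ih2
    exact ⟨bracket _ 𝒱 x y, (isColoredLieBracket _ 𝒱).graded d e x y hx hy, toFreeLie_bracket 𝒱 x y⟩

theorem wordBracket_trivialColoring (c : X → A) (u v : FreeAlgebra ℂ X) :
    wordBracket (trivialColoring A) c u v = ⁅u, v⁆ := by
  suffices h : wordBracket (trivialColoring A) c =
      LinearMap.mul ℂ (FreeAlgebra ℂ X) - (LinearMap.mul ℂ (FreeAlgebra ℂ X)).flip from
    LinearMap.congr_fun (LinearMap.congr_fun h u) v
  refine (wordBasis X).ext fun l => (wordBasis X).ext fun k => ?_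
  rw [wordBasis_apply, wordBasis_apply, wordBracket_word, trivialColoring_val, one_smul]
  rfl

variable {𝒱} {b : Module.Basis X ℂ V} {δ : X → Γ × A} (hb : IsHomogeneousBasis 𝒱 b δ)

attribute [local instance 100] LieRing.ofAssociativeRing

/-- The embedding into words factors through the free Lie algebra, so `toFreeLie` inherits
injectivity on homogeneous subspaces. -/
theorem lift_toFreeLie (x : FreeLieSuperalgebra (trivialColoring A) 𝒱) :
    FreeLie.lift (toFree b) (toFreeLie 𝒱 x) = toWords (trivialColoring A) hb x := by
  suffices h : (FreeLie.lift (toFree b)).toLinearMap ∘ₗ toFreeLie 𝒱 =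
      toWords (trivialColoring A) hb from LinearMap.congr_fun h x
  refine linearMap_ext _ 𝒱 (wordBracket (trivialColoring A) fun x => (δ x).2) _ _ (fun x y => ?_)
    (toWords_bracket _ hb) fun v => ?_
  · rw [wordBracket_trivialColoring, LinearMap.comp_apply, toFreeLie_bracket, lieBracketₗ_apply]
    exact LieHom.map_lie (FreeLie.lift (toFree b)) _ _
  · rw [toWords_ι, LinearMap.comp_apply, toFreeLie_ι]
    exact FreeLie.lift_ι (toFree b) v

/-- The homogeneous subspaces of the free Lie algebra and of the free colored Lie superalgebra with
trivial coloring are isomorphic. -/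
noncomputable def pieceEquiv (d : Γ × A) :
    FreeLieSuperalgebra.piece (trivialColoring A) 𝒱 d ≃ₗ[ℂ] FreeLie.piece 𝒱 d :=
  LinearEquiv.ofBijective ((toFreeLie 𝒱).restrict fun x hx => toFreeLie_mem 𝒱 (d := d) hx) (by
    constructor
    · intro x y h
      have h1 := congrArg (fun t => normDynkin (trivialColoring A) 𝒱 b
        (FreeLie.lift (toFree b) t.1)) h
      simp only [LinearMap.coe_restrict_apply, lift_toFreeLie hb,
        normDynkin_toWords _ hb x.2, normDynkin_toWords _ hb y.2] at h1
      exact Subtype.ext h1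
    · rintro ⟨y, hy⟩
      obtain ⟨x, hx, rfl⟩ := exists_toFreeLie_eq 𝒱 hy
      exact ⟨⟨x, hx⟩, rfl⟩)

variable {G : Type*} [Group G] (ρ : Representation ℂ G V)
  (hρ : ∀ g d, ∀ v ∈ 𝒱 d, ρ g v ∈ 𝒱 d)

theorem toFreeLie_rep (g : G) (x : FreeLieSuperalgebra (trivialColoring A) 𝒱) :
    toFreeLie 𝒱 (FreeLieSuperalgebra.rep _ 𝒱 ρ hρ g x) = FreeLie.rep ρ g (toFreeLie 𝒱 x) := by
  suffices h : toFreeLie 𝒱 ∘ₗ FreeLieSuperalgebra.rep (trivialColoring A) 𝒱 ρ hρ g =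
      FreeLie.rep ρ g ∘ₗ toFreeLie 𝒱 from LinearMap.congr_fun h x
  refine linearMap_ext _ 𝒱 (lieBracketₗ V) _ _ (fun x y => ?_) (fun x y => ?_) fun v => ?_
  · simp only [LinearMap.comp_apply, FreeLieSuperalgebra.rep_bracket, toFreeLie_bracket]
  · simp only [LinearMap.comp_apply, toFreeLie_bracket, lieBracketₗ_apply, FreeLie.rep_lie]
  · simp only [LinearMap.comp_apply, FreeLieSuperalgebra.rep_ι, toFreeLie_ι, FreeLie.rep_ι]

include hb in
theorem freeLie_tr_eq (g : G) (d : Γ × A) : FreeLie.tr 𝒱 ρ hρ g d =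
    LinearMap.trace ℂ (FreeLieSuperalgebra.piece (trivialColoring A) 𝒱 d)
      ((FreeLieSuperalgebra.rep _ 𝒱 ρ hρ g).restrict (FreeLieSuperalgebra.rep_mem _ 𝒱 ρ hρ g d)) := by
  rw [FreeLie.tr, ← LinearMap.trace_conj' (FreeLieSuperalgebra.rep _ 𝒱 ρ hρ g |>.restrict _) (pieceEquiv hb d)]
  congr 1
  refine LinearMap.ext fun y => ?_
  obtain ⟨x, rfl⟩ := (pieceEquiv hb d).surjective y
  rw [LinearEquiv.conj_apply_apply, LinearEquiv.symm_apply_apply]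
  exact Subtype.ext (toFreeLie_rep ρ hρ g x).symm

end FreeLie

end FreeColoredLie

namespace FreeColoredLie

/-! ### Comparison of the traces -/

section Comparison

variable {Γ A V G X : Type*} [AddCommSemigroup Γ] [AddCommGroup A] [AddCommGroup V] [Module ℂ V]
  [Group G] (θ : ColoringMap A) {𝒱 : Γ × A → Submodule ℂ V}

/-- The refined comparison of dimensions, for a fixed degree and eigenvalue. -/
theorem evDim_eq {δ : X → Γ × A} (hW : FinitelyManyWords δ) (ev : X → ℂ) {d : Γ × A}
    (hfin : (oddHalves θ d).Finite) (Λ : Finset ℂ)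
    (hΛ : ∀ e ∈ oddHalves θ d, ∀ l ∈ wordsOfDeg (coeDeg δ) (e : WithZero (Γ × A)),
      (l.map ev).prod ∈ Λ) (c : ℂ) :
    evDim θ δ ev d c = evDim (trivialColoring A) δ ev d c +
      ∑ p ∈ (hfin.toFinset ×ˢ Λ) with p.2 ^ 2 = c, evDim (trivialColoring A) δ ev p.1 p.2 := by
  classical
  let j : (Γ × A) × ℂ ↪ WithZero (Γ × A) × Additive ℂ :=
    ⟨fun p => (p.1, Additive.ofMul p.2), fun p q h => by
      rw [Prod.mk.injEq] at h
      exact Prod.ext (WithZero.coe_injective h.1) (Additive.ofMul.injective h.2)⟩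
  have h := finrank_liePoly_eq_add_sum (m := ((d : WithZero (Γ × A)), Additive.ofMul c)) θ
    (evColor Γ A) (((hfin.toFinset ×ˢ Λ).filter fun p => p.2 ^ 2 = c).map j) ?_ _ (evDeg δ ev)
    (wordsOfDeg_evDeg_finite hW ev d c) rfl ?_
  · rw [Finset.sum_map] at h
    simp only [evDim]
    rw [h]
    push_cast
    rfl
  · intro e he
    obtain ⟨⟨y, ν⟩, hy, rfl⟩ := Finset.mem_map.mp he
    simp only [Finset.mem_filter, Finset.mem_product, Set.Finite.mem_toFinset] at hy
    obtain ⟨⟨⟨hyd, ho⟩, -⟩, hν⟩ := hy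
    refine ⟨Prod.ext ?_ ?_, ?_⟩
    · exact (WithZero.coe_add y y).symm.trans (congrArg _ hyd)
    · change Additive.ofMul (ν * ν) = Additive.ofMul c
      rw [← hν, sq]
    · exact (congrArg θ.IsOdd (colorHom_coe y)).mpr ho
  · rintro ⟨e, ν⟩ he ho ⟨l, hl⟩
    have he1 : e + e = (d : WithZero (Γ × A)) := congrArg Prod.fst he
    have he2 : Additive.toMul ν * Additive.toMul ν = c := congrArg (fun p => p.2.toMul) he
    have hl' := (mem_wordsOfDeg_evDeg ev e (Additive.toMul ν) l).mp hl
    cases e with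
    -- The adjoined zero is not a half of `d`, because twice it is again zero.
    | zero => exact absurd he1.symm (by rw [add_zero]; exact WithZero.coe_ne_zero)
    | coe y =>
      have hy : y ∈ oddHalves θ d :=
        ⟨WithZero.coe_injective ((WithZero.coe_add y y).trans he1),
          (congrArg θ.IsOdd (colorHom_coe y)).mp ho⟩
      refine Finset.mem_map.mpr ⟨(y, Additive.toMul ν), ?_, rfl⟩
      simp only [Finset.mem_filter, Finset.mem_product, Set.Finite.mem_toFinset]
      refine ⟨⟨hy, ?_⟩, by rw [sq, he2]⟩
      rw [← hl'.2]
      exact hΛ y hy l hl'.1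

variable (ρ : Representation ℂ G V) (hρ : ∀ g d, ∀ v ∈ 𝒱 d, ρ g v ∈ 𝒱 d)

/-- The comparison of traces, given a triangular basis. -/
theorem trace_rep_eq {b : Module.Basis X ℂ V} {δ : X → Γ × A} (hb : IsHomogeneousBasis 𝒱 b δ)
    (hW : FinitelyManyWords δ) {g : G} {rk : X → ℕ} {ev : X → ℂ}
    (hg : IsTriangular b (ρ g) rk ev) {d : Γ × A} (hfin : (oddHalves θ d).Finite) :
    LinearMap.trace ℂ (FreeLieSuperalgebra.piece θ 𝒱 d)
        ((FreeLieSuperalgebra.rep θ 𝒱 ρ hρ g).restrict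
          (FreeLieSuperalgebra.rep_mem θ 𝒱 ρ hρ g d)) =
      FreeLie.tr 𝒱 ρ hρ g d + ∑ y ∈ hfin.toFinset, FreeLie.tr 𝒱 ρ hρ (g ^ 2) y := by
  classical
  have hg2 : IsTriangular b (ρ (g ^ 2)) rk fun x => ev x ^ 2 := by
    have h : ρ (g ^ 2) = ρ g ∘ₗ ρ g := by rw [sq, map_mul]; rfl
    rw [h]
    exact hg.comp_self
  have hprod : ∀ l : List X, (l.map fun x => ev x ^ 2).prod = (l.map ev).prod ^ 2 := by
    intro l
    induction l with
    | nil => simp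
    | cons x l ih => simp [ih, mul_pow]
  let Λ₀ : Finset ℂ := hfin.toFinset.biUnion fun y => (hW y).toFinset.image fun l => (l.map ev).prod
  have hΛ₀ : ∀ y ∈ oddHalves θ d, ∀ l ∈ wordsOfDeg (coeDeg δ) (y : WithZero (Γ × A)),
      (l.map ev).prod ∈ Λ₀ := fun y hy l hl => Finset.mem_biUnion.mpr
    ⟨y, hfin.mem_toFinset.mpr hy, Finset.mem_image_of_mem _ ((hW y).mem_toFinset.mpr hl)⟩
  -- The squares are included so that the double sum over `Λ₀` can be fibered over `Λ` by squaring.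
  let Λ : Finset ℂ := ((hW d).toFinset.image fun l => (l.map ev).prod) ∪ Λ₀.image fun c => c ^ 2
  have hΛ : ∀ l ∈ wordsOfDeg (coeDeg δ) (d : WithZero (Γ × A)), (l.map ev).prod ∈ Λ := fun l hl =>
    Finset.mem_union_left _ (Finset.mem_image_of_mem _ ((hW d).mem_toFinset.mpr hl))
  have hsq : ∀ p ∈ hfin.toFinset ×ˢ Λ₀, p.2 ^ 2 ∈ Λ := fun p hp =>
    Finset.mem_union_right _ (Finset.mem_image_of_mem _ (Finset.mem_product.mp hp).2)
  have h2 : ∀ y ∈ hfin.toFinset, FreeLie.tr 𝒱 ρ hρ (g ^ 2) y =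
      ∑ c ∈ Λ₀, c ^ 2 * evDim (trivialColoring A) δ ev y c := by
    intro y hy
    rw [freeLie_tr_eq hb ρ hρ, trace_rep _ hb ρ hρ hW _ hg2]
    simp only [hprod]
    exact sum_diagCoeff_mul _ hb hW ev (fun c => c ^ 2) y Λ₀ (hΛ₀ y (hfin.mem_toFinset.mp hy))
  rw [freeLie_tr_eq hb ρ hρ, trace_rep _ hb ρ hρ hW g hg, trace_rep _ hb ρ hρ hW g hg,
    sum_diagCoeff_mul _ hb hW ev (fun c => c) d Λ hΛ,
    sum_diagCoeff_mul _ hb hW ev (fun c => c) d Λ hΛ, Finset.sum_congr rfl h2,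
    ← Finset.sum_product', ← Finset.sum_fiberwise_of_maps_to hsq, ← Finset.sum_add_distrib]
  refine Finset.sum_congr rfl fun c _ => ?_
  rw [evDim_eq θ hW ev hfin Λ₀ hΛ₀ c, mul_add, Finset.mul_sum]
  congr 1
  refine Finset.sum_congr rfl fun p hp => ?_
  rw [(Finset.mem_filter.mp hp).2]

/-- If `d = 2y`, then `ψ(d) = ψ(y)⁴ = 1`; otherwise the sum is empty. -/
theorem sign_mul_sum_oddHalves {d : Γ × A} (hfin : (oddHalves θ d).Finite) (F : Γ × A → ℂ) :
    θ.sign d.2 * ∑ y ∈ hfin.toFinset, F y = ∑ y ∈ hfin.toFinset, F y := by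
  rcases (oddHalves θ d).eq_empty_or_nonempty with h | ⟨y, hy, -⟩
  · simp [h]
  · have h : θ.sign d.2 = 1 := by
      rw [← hy, ColoringMap.sign, Prod.snd_add, θ.val_add_left, θ.val_add_right]
      rw [← sq, ← sq, ← pow_mul]
      rcases θ.sign_eq y.2 with h | h <;> rw [ColoringMap.sign] at h <;> rw [h] <;> norm_num
    rw [h, one_mul]

theorem trace_restrict_one {M : Type*} [AddCommGroup M] [Module ℂ M] {N : Submodule ℂ M}
    [FiniteDimensional ℂ N] (f : M →ₗ[ℂ] M) (hf : f = 1) (h : ∀ x ∈ N, f x ∈ N) :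
    LinearMap.trace ℂ N (f.restrict h) = (Module.finrank ℂ N : ℂ) := by
  subst hf
  exact LinearMap.trace_one ℂ N

end Comparison

end FreeColoredLie

theorem proposition4p2 {Γ A G V : Type*} [AddCommSemigroup Γ] [Countable Γ] [DecidableEq Γ]
    [AddCommGroup A] [Countable A] [DecidableEq A] (hfin : FiniteDecompositions (Γ × A))
    (θ : ColoringMap A) [AddCommGroup V] [Module ℂ V]
    (𝒱 : Γ × A → Submodule ℂ V) (h𝒱 : DirectSum.IsInternal 𝒱)
    (hdim : ∀ d, FiniteDimensional ℂ (𝒱 d))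
    [Group G] (ρ : Representation ℂ G V) (hρ : ∀ g d, ∀ v ∈ 𝒱 d, ρ g v ∈ 𝒱 d) :
    (∀ d : Γ × A, FiniteDimensional ℂ (FreeLie.piece 𝒱 d) ∧
      FiniteDimensional ℂ (FreeLieSuperalgebra.piece θ 𝒱 d)) ∧
    (∀ (g : G) (α : Γ) (a : A),
      FreeLieSuperalgebra.str θ 𝒱 ρ hρ g (α, a) =
        θ.sign a * FreeLie.tr 𝒱 ρ hρ g (α, a) +
          ∑ y ∈ (oddHalves_finite hfin θ (α, a)).toFinset, FreeLie.tr 𝒱 ρ hρ (g ^ 2) y) ∧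
    (∀ (α : Γ) (a : A),
      FreeLieSuperalgebra.sdim θ 𝒱 (α, a) =
        θ.sign a * (Module.finrank ℂ (FreeLie.piece 𝒱 (α, a)) : ℂ) +
          ∑ y ∈ (oddHalves_finite hfin θ (α, a)).toFinset,
            (Module.finrank ℂ (FreeLie.piece 𝒱 y) : ℂ)) := by
  have hW : FreeColoredLie.FinitelyManyWords
      (Sigma.fst : (Σ d, Fin (Module.finrank ℂ (𝒱 d))) → Γ × A) := by
    refine FreeColoredLie.finitelyManyWords _ (fun d => ?_) hfin
    refine (Set.finite_range (Sigma.mk d)).subset ?_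
    rintro ⟨e, i⟩ rfl
    exact ⟨i, rfl⟩
  have htr : ∀ (g : G) (α : Γ) (a : A), FreeLieSuperalgebra.str θ 𝒱 ρ hρ g (α, a) =
      θ.sign a * FreeLie.tr 𝒱 ρ hρ g (α, a) +
        ∑ y ∈ (oddHalves_finite hfin θ (α, a)).toFinset, FreeLie.tr 𝒱 ρ hρ (g ^ 2) y := by
    intro g α a
    obtain ⟨b, rk, ev, hb, hg⟩ :=
      FreeColoredLie.exists_homogeneous_triangular_basis 𝒱 h𝒱 hdim (ρ g) (hρ g)
    rw [FreeLieSuperalgebra.str, FreeColoredLie.trace_rep_eq θ ρ hρ hb hW hg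
      (oddHalves_finite hfin θ (α, a)), mul_add, FreeColoredLie.sign_mul_sum_oddHalves]
  have hdims : ∀ d : Γ × A, FiniteDimensional ℂ (FreeLie.piece 𝒱 d) ∧
      FiniteDimensional ℂ (FreeLieSuperalgebra.piece θ 𝒱 d) := by
    intro d
    obtain ⟨b, rk, ev, hb, hg⟩ :=
      FreeColoredLie.exists_homogeneous_triangular_basis 𝒱 h𝒱 hdim (ρ 1) (hρ 1)
    have h1 := FreeColoredLie.finiteDimensional_piece (FreeColoredLie.trivialColoring A) hb hW d
    exact ⟨(FreeColoredLie.pieceEquiv hb d).finiteDimensional,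
      FreeColoredLie.finiteDimensional_piece θ hb hW d⟩
  refine ⟨hdims, htr, fun α a => ?_⟩
  have h := htr 1 α a
  have hL : ∀ y, FreeLie.tr 𝒱 ρ hρ 1 y = (Module.finrank ℂ (FreeLie.piece 𝒱 y) : ℂ) := fun y =>
    have := (hdims y).1
    FreeColoredLie.trace_restrict_one _ (map_one _) _
  have := (hdims (α, a)).2
  simp only [one_pow, hL] at h
  -- For `g = 1` the supertrace is the superdimension, and `g² = 1` turns the remaining traces into
  -- dimensions.
  rw [← h, FreeLieSuperalgebra.str, FreeColoredLie.trace_restrict_one _ (map_one _)]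
  rfl
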